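/- **Setting.** Let $G=(V,E)$ be a graph with $n$ vertices, $w:V\to\mathbb{R}_{>0}$ vertex weights, and $0<\varepsilon<1/2$. Vertices are frozen or nonfrozen (initially nonfrozen); an edge is frozen iff at least one endpoint is, and a frozen edge $e$ has a finalized weight $x_e^{MPC}$. Let $d(v)$ be the number of nonfrozen neighbours of $v$ and $d=\frac1n\sum_{v\text{ nonfrozen}}d(v)$. The MPC algorithm performs, as long as $d>\log^{30}n$, a phase as follows. 1. $V^{high}=\{v\text{ nonfrozen}: d(v)\ge d^{0.95}\}$, $V^{inactive}=\{v\text{ nonfrozen}: d(v)< d^{0.95}\}$, $w'(v)=w(v)-\sum_{e\ni v\text{ frozen}}x_e^{MPC}$, and $x_{e,0}^{MPC}=\min\{w'(u)/d(u),\,w'(v)/d(v)\}$ for $e=uv\in E[V^{high}]$ (the edges with both endpoints in $V^{high}$). 2. The number of machines is $m=\sqrt d$ (an integer obtained by rounding $\sqrt d$ down or up), and $I=\lfloor \log m/(10\log 15)\rfloor$. Draw independently thresholds $\mathcal T_{v,t}$ uniform in $[1-4\varepsilon,1-2\varepsilon]$ ($v\in V^{high}$, $0\le t<I$), and for each $v\in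 V^{high}$ a uniformly random machine; let $V_1,\dots,V_m$ be the resulting partition of $V^{high}$. 3. For $v\in V_i$ put $$\tilde y^{MPC}_{v,t}=2m^{-0.2}\,15^t\,w'(v)+m\sum_{e\ni v,\ e\in E[V_i]}x^{MPC}_{e,t}\qquad(0\le t\le I).$$ In iterations $t=0,\dots,I-1$, every active (not yet frozen) $v\in V^{high}$ with $\tilde y^{MPC}_{v,t}\ge\mathcal T_{v,t}w'(v)$ is frozen with its incident edges; then $x^{MPC}_{e,t+1}=x^{MPC}_{e,t}/(1-\varepsilon)$ for active edges and $x^{MPC}_{e,t+1}=x^{MPC}_{e,t}$ for frozen edges. This rule defines $x^{MPC}_{e,t}$ for all $e\in E[V^{high}]$, including edges between different machines. Put $y^{MPC}_{v,t}=\sum_{e\ni v,\,e\in E[V^{high}]}x^{MPC}_{e,t}$. 4. Finally $x_e^{MPC}:=x_{e,I}^{MPC}$ for $e\in E[V^{high}]$; every still active $v\in V^{high}$ with $y^{MPC}_{v,I}\ge w'(v)$ is frozen; $x^{MPC}_e:=0$ for edges between $V^{inactive}$ and $V^{high}$. Compare one such phase with the centralized algorithm on $G[V^{high}]$, run for $I$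 iterations with the same vertex weights $w'$, initial edge weights $x_{e,0}=x_{e,0}^{MPC}$ and thresholds $\mathcal T_{v,t}$: in iteration $t$ every active $v$ with $y_{v,t}:=\sum_{e\ni v}x_{e,t}\ge\mathcal T_{v,t}w'(v)$ is frozen with its incident edges, and then $x_{e,t+1}=x_{e,t}/(1-\varepsilon)$ for active edges and $x_{e,t+1}=x_{e,t}$ for frozen edges. **Lemma.** For every $0<\varepsilon<1/2$ and every $c>0$ there is an $N$ such that for every $G$ with $n\ge N$ vertices, all positive vertex weights $w$, and every status (set of frozen vertices and edge weights) that the MPC algorithm can reach at the beginning of a phase, the following holds with probability at least $1-n^{-c}$ over the random choices of that phase: for all integers $0\le t\le I$ and all $v\in V^{high}$, $$|y_{v,t}-\tilde y^{MPC}_{v,t}|\le 6\varepsilon\, w'(v)\qquad\text{and}\qquad |y_{v,t}-y^{MPC}_{v,t}|\le 6\varepsilon\, w'(v).$$ -/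

import Mathlib

namespace MWVC

/-! ### The iterative primal-dual process on a weighted graph -/

/-- Status of a run on a graph with vertex type `U`: the set of frozen vertices (the others are
active) and the edge weights; `x u v` is the weight of the edge `uv` and is only read when `u` and
`v` are adjacent. An edge is active iff both of its endpoints are active. -/
structure RunState (U : Type*) where
  frozen : Finset U
  x : U → U → ℝ

open scoped Classical in
/-- `y_v = ∑_{e ∋ v} x_e`, the sum over all edges of `H` at `v`. -/
noncomputable def incident {U : Type*} [Fintype U] (H : SimpleGraph U) (x : U → U → ℝ)
    (v : U) : ℝ :=
  ∑ u with H.Adj v u, x v u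

open scoped Classical in
/-- `∑_{e ∋ v, e ∈ E[V_i]} x_e` where `V_i` is the part (machine) containing `v`, the partition
being given by `a : U → Fin m`. -/
noncomputable def localIncident {U : Type*} [Fintype U] (H : SimpleGraph U) {m : ℕ}
    (a : U → Fin m) (x : U → U → ℝ) (v : U) : ℝ :=
  ∑ u with H.Adj v u ∧ a u = a v, x v u

open scoped Classical in
/-- One iteration: every active vertex that passes the freezing test is frozen, together with its
incident edges; afterwards the weight of every active edge is divided by `1 - ε`, and the weight of
every frozen edge is kept. -/
noncomputable def iterStep {U : Type*} [Fintype U] (ε : ℝ) (test : (U → U → ℝ) → U → Prop)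
    (s : RunState U) : RunState U :=
  let F : Finset U := s.frozen ∪ Finset.univ.filter (fun v => v ∉ s.frozen ∧ test s.x v)
  { frozen := F
    x := fun u v => if u ∈ F ∨ v ∈ F then s.x u v else s.x u v / (1 - ε) }

/-- The centralized algorithm on the graph `H` with vertex weights `w`, initial edge weights `x₀`
and thresholds `T v t`: status at the start of iteration `t`. -/
noncomputable def central {U : Type*} [Fintype U] (H : SimpleGraph U) (ε : ℝ) (w : U → ℝ)
    (x₀ : U → U → ℝ) (T : U → ℕ → ℝ) : ℕ → RunState U
  | 0 => ⟨∅, x₀⟩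
  | t + 1 => iterStep ε (fun x v => T v t * w v ≤ incident H x v) (central H ε w x₀ T t)

/-- The estimator computed by a machine at iteration `t`:
`2 m^{-0.2} 15^t w(v) + m ∑_{e ∋ v, e ∈ E[V_i]} x_e`. -/
noncomputable def estimate {U : Type*} [Fintype U] (H : SimpleGraph U) (w : U → ℝ) {m : ℕ}
    (a : U → Fin m) (t : ℕ) (x : U → U → ℝ) (v : U) : ℝ :=
  2 * (m : ℝ) ^ (-(0.2 : ℝ)) * 15 ^ t * w v + m * localIncident H a x v

/-- The local simulation on the `m` machines, all machines in parallel: status at the start of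
iteration `t`. The freezing decisions of a vertex only read edges inside its own machine. The edge
weights are recorded for all edges of `H`: also a cross-partition edge keeps its initial weight
divided by `(1 - ε)^{t'}`, where `t'` is the earliest iteration in which one of its endpoints
was frozen (or the current time, if both endpoints are still active). -/
noncomputable def simulate {U : Type*} [Fintype U] (H : SimpleGraph U) (ε : ℝ) (w : U → ℝ)
    (x₀ : U → U → ℝ) {m : ℕ} (a : U → Fin m) (T : U → ℕ → ℝ) : ℕ → RunState U
  | 0 => ⟨∅, x₀⟩
  | t + 1 => iterStep ε (fun x v => T v t * w v ≤ estimate H w a t x v)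
      (simulate H ε w x₀ a T t)

/-! ### The phases of the MPC algorithm -/

/-- Status of the MPC algorithm between two phases: the frozen vertices, and the edge weights
`x u v = x_{uv}^{MPC}`. An edge is frozen iff at least one of its endpoints is frozen, and only the
weights of frozen edges are read by later phases. -/
structure State (V : Type*) where
  frozen : Finset V
  x : V → V → ℝ


open scoped Classical in
/-- The residual degree `d(v)`: the number of nonfrozen neighbours of `v`. -/
noncomputable def resDeg {V : Type*} [Fintype V] (G : SimpleGraph V) (σ : State V) (v : V) : ℕ :=
  (Finset.univ.filter (fun u => G.Adj v u ∧ u ∉ σ.frozen)).card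

open scoped Classical in
/-- `d = (1/n) ∑_{v nonfrozen} d(v)`. -/
noncomputable def avgDeg {V : Type*} [Fintype V] (G : SimpleGraph V) (σ : State V) : ℝ :=
  (∑ v with v ∉ σ.frozen, (resDeg G σ v : ℝ)) / Fintype.card V

open scoped Classical in
/-- `V^high`: the nonfrozen vertices with `d(v) ≥ d^{0.95}`. -/
noncomputable def high {V : Type*} [Fintype V] (G : SimpleGraph V) (σ : State V) : Finset V :=
  Finset.univ.filter (fun v => v ∉ σ.frozen ∧ avgDeg G σ ^ (0.95 : ℝ) ≤ (resDeg G σ v : ℝ))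

open scoped Classical in
/-- `V^inactive`: the nonfrozen vertices with `d(v) < d^{0.95}`. -/
noncomputable def inactive {V : Type*} [Fintype V] (G : SimpleGraph V) (σ : State V) : Finset V :=
  Finset.univ.filter (fun v => v ∉ σ.frozen ∧ (resDeg G σ v : ℝ) < avgDeg G σ ^ (0.95 : ℝ))

open scoped Classical in
/-- The residual weight `w'(v) = w(v) - ∑_{e ∋ v, e frozen} x_e^{MPC}`. -/
noncomputable def resWeight {V : Type*} [Fintype V] (G : SimpleGraph V) (w : V → ℝ)
    (σ : State V) (v : V) : ℝ :=
  w v - ∑ u with G.Adj v u ∧ (v ∈ σ.frozen ∨ u ∈ σ.frozen), σ.x v u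

/-- The subgraph `G[V^high]` induced by `V^high`. -/
noncomputable def highGraph {V : Type*} [Fintype V] (G : SimpleGraph V) (σ : State V) :
    SimpleGraph (high G σ) :=
  G.comap Subtype.val

/-- The residual weights on `V^high`. -/
noncomputable def highWeight {V : Type*} [Fintype V] (G : SimpleGraph V) (w : V → ℝ)
    (σ : State V) (v : high G σ) : ℝ :=
  resWeight G w σ v

/-- The initial edge weights `x_{uv,0} = min (w'(u)/d(u)) (w'(v)/d(v))` on `G[V^high]`. -/
noncomputable def initWeight {V : Type*} [Fintype V] (G : SimpleGraph V) (w : V → ℝ)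
    (σ : State V) (u v : high G σ) : ℝ :=
  min (resWeight G w σ u / (resDeg G σ u : ℝ)) (resWeight G w σ v / (resDeg G σ v : ℝ))

/-- The number of iterations in a phase, `I = log m / (10 log 15)`, rounded down. -/
noncomputable def numIter (m : ℕ) : ℕ := ⌊Real.log m / (10 * Real.log 15)⌋₊

/-- `m` is a legitimate number of machines for the current phase: `√d`, rounded down or up. -/
def IsNumMachines {V : Type*} [Fintype V] (G : SimpleGraph V) (σ : State V) (m : ℕ) : Prop :=
  |(m : ℝ) - √(avgDeg G σ)| < 1

/-- Thresholds `T v t` for `t < I`, as a function of all `t : ℕ`. The values for `t ≥ I` are never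
used in the first `I` iterations. -/
def thresholds {U : Type*} {I : ℕ} (T : U → Fin I → ℝ) (v : U) (t : ℕ) : ℝ :=
  if h : t < I then T v ⟨t, h⟩ else 0

/-- The random choices of a phase: the thresholds `T v t`, for `v ∈ V^high` and `0 ≤ t < I`, and
the machine to which each `v ∈ V^high` is assigned. -/
abbrev Choices {V : Type*} [Fintype V] (G : SimpleGraph V) (σ : State V) (m : ℕ) : Type _ :=
  (high G σ → Fin (numIter m) → ℝ) × (high G σ → Fin m)

/-- The law of the random choices: all of them are independent, the thresholds are uniform on
`[1 - 4ε, 1 - 2ε]`, and the machines are uniform on the `m` machines. -/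
noncomputable def choiceLaw {V : Type*} [Fintype V] (G : SimpleGraph V) (ε : ℝ) (σ : State V)
    (m : ℕ) : MeasureTheory.Measure (Choices G σ m) :=
  (MeasureTheory.Measure.pi fun _ => MeasureTheory.Measure.pi fun _ =>
      ProbabilityTheory.cond MeasureTheory.volume (Set.Icc (1 - 4 * ε) (1 - 2 * ε))).prod
    (MeasureTheory.Measure.pi fun _ => ProbabilityTheory.uniformOn Set.univ)

/-- The centralized algorithm on `G[V^high]`, with the residual weights, initial edge weights and
thresholds of the phase: status at the start of iteration `t`. -/
noncomputable def phaseCentral {V : Type*} [Fintype V] (G : SimpleGraph V) (w : V → ℝ) (ε : ℝ)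
    (σ : State V) {m : ℕ} (ω : Choices G σ m) (t : ℕ) : RunState (high G σ) :=
  central (highGraph G σ) ε (highWeight G w σ) (initWeight G w σ) (thresholds ω.1) t

/-- The simulation performed by the machines in the phase: status at the start of iteration `t`. -/
noncomputable def phaseMPC {V : Type*} [Fintype V] (G : SimpleGraph V) (w : V → ℝ) (ε : ℝ)
    (σ : State V) {m : ℕ} (ω : Choices G σ m) (t : ℕ) : RunState (high G σ) :=
  simulate (highGraph G σ) ε (highWeight G w σ) (initWeight G w σ) ω.2 (thresholds ω.1) t

/-- `y_{v,t}`. -/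
noncomputable def yCentral {V : Type*} [Fintype V] (G : SimpleGraph V) (w : V → ℝ) (ε : ℝ)
    (σ : State V) {m : ℕ} (ω : Choices G σ m) (v : high G σ) (t : ℕ) : ℝ :=
  incident (highGraph G σ) (phaseCentral G w ε σ ω t).x v

/-- `y_{v,t}^{MPC}`. -/
noncomputable def yMPC {V : Type*} [Fintype V] (G : SimpleGraph V) (w : V → ℝ) (ε : ℝ)
    (σ : State V) {m : ℕ} (ω : Choices G σ m) (v : high G σ) (t : ℕ) : ℝ :=
  incident (highGraph G σ) (phaseMPC G w ε σ ω t).x v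

/-- `ỹ_{v,t}^{MPC}`. -/
noncomputable def yTildeMPC {V : Type*} [Fintype V] (G : SimpleGraph V) (w : V → ℝ) (ε : ℝ)
    (σ : State V) {m : ℕ} (ω : Choices G σ m) (v : high G σ) (t : ℕ) : ℝ :=
  estimate (highGraph G σ) (highWeight G w σ) ω.2 t (phaseMPC G w ε σ ω t).x v

open scoped Classical in
/-- The status after the phase with random choices `ω`. The vertices frozen during the simulation
stay frozen; in addition every active `v ∈ V^high` with `y_v^{MPC} ≥ w'(v)` is frozen. The edges
in `E[V^high]` get the weights at the end of the simulation, the edges in `E[V^inactive; V^high]`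
get weight `0`, and the weights of all other edges are unchanged. -/
noncomputable def nextState {V : Type*} [Fintype V] (G : SimpleGraph V) (w : V → ℝ) (ε : ℝ)
    (σ : State V) {m : ℕ} (ω : Choices G σ m) : State V where
  frozen := σ.frozen ∪
    ((phaseMPC G w ε σ ω (numIter m)).frozen ∪
      Finset.univ.filter (fun v => v ∉ (phaseMPC G w ε σ ω (numIter m)).frozen ∧
        highWeight G w σ v ≤ yMPC G w ε σ ω v (numIter m))).image Subtype.val
  x u v :=
    if h : u ∈ high G σ ∧ v ∈ high G σ then
      (phaseMPC G w ε σ ω (numIter m)).x ⟨u, h.1⟩ ⟨v, h.2⟩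
    else if (u ∈ high G σ ∧ v ∈ inactive G σ) ∨ (u ∈ inactive G σ ∧ v ∈ high G σ) then 0
    else σ.x u v

/-- The condition `d > log^30 n` under which the MPC algorithm performs another phase. -/
def PhaseRuns {V : Type*} [Fintype V] (G : SimpleGraph V) (σ : State V) : Prop :=
  Real.log (Fintype.card V) ^ 30 < avgDeg G σ

/-- The statuses the MPC algorithm on `(G, w)` can have before a phase: at the beginning nothing is
frozen, and each phase may be run with any admissible outcome of its random choices. -/
inductive Reachable {V : Type*} [Fintype V] (G : SimpleGraph V) (w : V → ℝ) (ε : ℝ) :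
    State V → Prop
  | start : Reachable G w ε ⟨∅, fun _ _ => 0⟩
  | phase (σ : State V) (m : ℕ) (ω : Choices G σ m) (hσ : Reachable G w ε σ)
      (hrun : PhaseRuns G σ) (hm : IsNumMachines G σ m)
      (hT : ∀ v t, ω.1 v t ∈ Set.Icc (1 - 4 * ε) (1 - 2 * ε)) :
      Reachable G w ε (nextState G w ε σ ω)


end MWVC

/-! The bias `2 m^{-0.2} 15^t` makes the comparison one-sided. As long as it dominates the error of
the estimator, the simulation freezes every vertex no later than the centralized run does, so its
edge weights are never larger. The runs can then drift apart only through vertices that the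
simulation freezes prematurely.

A premature freeze of `u` in iteration `t` forces the threshold of `u` into a window of length `2 *
bias m t` above `y_{u,t} / w u`. That window depends only on earlier thresholds, so a fresh
threshold hits it with probability at most `bias m t / ε`. By a Chernoff bound, the premature weight
gained at a surviving vertex `v`, whose sum is at most `w v`, is at most `2 * (bias m t / ε) * w v`.
An existing discrepancy at most doubles per iteration, and premature weight adds at most `2ε` times
its size. The factor 15 by which the bias grows absorbs both, so the discrepancy stays below half
the bias (`Coupled.closeAt_succ`). The other source of error is sampling: the centralized run
ignores the partition, so for fixed thresholds its rescaled local sums are sums of independent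
indicators and concentrate around `y_{v,t}` (`PhaseBounds.sample_event_le`).

`Typical` collects the likely events. `coupled_of_typical` and `abs_sub_le_of_typical` are
deterministic consequences of it, and `PhaseBounds.measureReal_not_typical_le` bounds its failure by
a union bound. With `z = m^{0.1}` each Chernoff bound is at most `exp(-z/2 + 1)`. Since `d > log^30
n`, `z` exceeds any prescribed multiple of `log n` for large `n`, which beats the polynomially many
events. Reachability enters only through positivity of the residual weights
(`resWeight_pos_of_reachable`). -/

namespace MWVC

/-! ### Deterministic comparison of the two processes. -/

section Deterministic

open scoped Classical in
/-- The coefficients of the sum over all edges at `v`. -/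
noncomputable def globalCoeff {U : Type*} (H : SimpleGraph U) (v u : U) : ℝ := if H.Adj v u then 1 else 0

open scoped Classical in
/-- The coefficients of the rescaled sum over the edges at `v` inside the machine of `v`. -/
noncomputable def localCoeff {U : Type*} (H : SimpleGraph U) {m : ℕ} (a : U → Fin m) (v u : U) : ℝ :=
  if H.Adj v u ∧ a u = a v then m else 0

theorem globalCoeff_nonneg {U : Type*} (H : SimpleGraph U) (v u : U) : 0 ≤ globalCoeff H v u := by
  unfold globalCoeff; split_ifs <;> norm_num

theorem localCoeff_nonneg {U : Type*} (H : SimpleGraph U) {m : ℕ} (a : U → Fin m) (v u : U) :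
    0 ≤ localCoeff H a v u := by
  unfold localCoeff; split_ifs <;> positivity

variable {U : Type*} [Fintype U]

theorem mem_frozen_iterStep {ε : ℝ} {test : (U → U → ℝ) → U → Prop} {s : RunState U} {v : U} :
    v ∈ (iterStep ε test s).frozen ↔ v ∈ s.frozen ∨ test s.x v := by
  classical
  simp only [iterStep, Finset.mem_union, Finset.mem_filter, Finset.mem_univ, true_and]
  tauto

theorem iterStep_x_of_mem {ε : ℝ} {test : (U → U → ℝ) → U → Prop} {s : RunState U} {u v : U}
    (h : u ∈ (iterStep ε test s).frozen ∨ v ∈ (iterStep ε test s).frozen) :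
    (iterStep ε test s).x u v = s.x u v :=
  if_pos h

theorem iterStep_x_of_notMem {ε : ℝ} {test : (U → U → ℝ) → U → Prop} {s : RunState U} {u v : U}
    (hu : u ∉ (iterStep ε test s).frozen) (hv : v ∉ (iterStep ε test s).frozen) :
    (iterStep ε test s).x u v = s.x u v / (1 - ε) :=
  if_neg (by simp only [not_or]; exact ⟨hu, hv⟩)

theorem le_div_one_sub {ε a : ℝ} (hε : 0 < ε) (hε' : ε < 1 / 2) (ha : 0 ≤ a) :
    a ≤ a / (1 - ε) := by
  rw [le_div_iff₀ (by linarith)]; nlinarith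

theorem div_one_sub_le {ε a : ℝ} (hε' : ε < 1 / 2) (ha : 0 ≤ a) :
    a / (1 - ε) ≤ 2 * a := by
  rw [div_le_iff₀ (by linarith)]; nlinarith

theorem le_iterStep_x {ε : ℝ} (hε : 0 < ε) (hε' : ε < 1 / 2) {test : (U → U → ℝ) → U → Prop}
    {s : RunState U} {u v : U} (h : 0 ≤ s.x u v) : s.x u v ≤ (iterStep ε test s).x u v := by
  by_cases hm : u ∈ (iterStep ε test s).frozen ∨ v ∈ (iterStep ε test s).frozen
  · rw [iterStep_x_of_mem hm]
  · rw [iterStep_x_of_notMem (fun h => hm (.inl h)) (fun h => hm (.inr h))]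
    exact le_div_one_sub hε hε' h

theorem iterStep_x_le_div {ε : ℝ} (hε : 0 < ε) (hε' : ε < 1 / 2)
    {test : (U → U → ℝ) → U → Prop} {s : RunState U} {u v : U} (h : 0 ≤ s.x u v) :
    (iterStep ε test s).x u v ≤ s.x u v / (1 - ε) := by
  by_cases hm : u ∈ (iterStep ε test s).frozen ∨ v ∈ (iterStep ε test s).frozen
  · rw [iterStep_x_of_mem hm]
    exact le_div_one_sub hε hε' h
  · rw [iterStep_x_of_notMem (fun h => hm (.inl h)) (fun h => hm (.inr h))]

/-- A nonnegative weighting of the edges at `v`, summed against the edge weights. -/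
noncomputable def edgeSum (g : U → ℝ) (x : U → U → ℝ) (v : U) : ℝ := ∑ u, g u * x v u

theorem incident_eq_edgeSum (H : SimpleGraph U) (x : U → U → ℝ) (v : U) :
    incident H x v = edgeSum (globalCoeff H v) x v := by
  simp [incident, edgeSum, globalCoeff, Finset.sum_filter]

theorem localIncident_eq_edgeSum (H : SimpleGraph U) {m : ℕ} (a : U → Fin m) (x : U → U → ℝ)
    (v : U) : m * localIncident H a x v = edgeSum (localCoeff H a v) x v := by
  simp [localIncident, edgeSum, localCoeff, Finset.sum_filter, Finset.mul_sum]

theorem edgeSum_mono {g : U → ℝ} (hg : ∀ u, 0 ≤ g u) {x x' : U → U → ℝ} {v : U}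
    (h : ∀ u, x v u ≤ x' v u) : edgeSum g x v ≤ edgeSum g x' v :=
  Finset.sum_le_sum fun u _ => mul_le_mul_of_nonneg_left (h u) (hg u)

/-- The bias of the estimator in iteration `t`, relative to the vertex weight. -/
noncomputable def bias (m t : ℕ) : ℝ := 2 * (m : ℝ) ^ (-(0.2 : ℝ)) * 15 ^ t

theorem bias_succ (m t : ℕ) : bias m (t + 1) = 15 * bias m t := by
  unfold bias; ring

theorem bias_nonneg (m t : ℕ) : 0 ≤ bias m t := by
  unfold bias; positivity

theorem bias_mono (m : ℕ) {s t : ℕ} (h : s ≤ t) : bias m s ≤ bias m t := by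
  unfold bias
  gcongr
  norm_num

theorem estimate_eq (H : SimpleGraph U) (w : U → ℝ) {m : ℕ} (a : U → Fin m) (t : ℕ)
    (x : U → U → ℝ) (v : U) :
    estimate H w a t x v = bias m t * w v + edgeSum (localCoeff H a v) x v := by
  rw [← localIncident_eq_edgeSum]; rfl

section Runs

variable (H : SimpleGraph U) (ε : ℝ) (w : U → ℝ) (x₀ : U → U → ℝ) {m : ℕ} (a : U → Fin m)
  (T : U → ℕ → ℝ)

theorem central_x_nonneg (hε' : ε < 1 / 2) (hx₀ : ∀ u v, 0 ≤ x₀ u v) (t : ℕ) (u v : U) :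
    0 ≤ (central H ε w x₀ T t).x u v := by
  induction t with
  | zero => exact hx₀ u v
  | succ t ih =>
    simp only [central, iterStep]
    split_ifs
    · exact ih
    · exact div_nonneg ih (by linarith)

theorem simulate_x_nonneg (hε' : ε < 1 / 2) (hx₀ : ∀ u v, 0 ≤ x₀ u v) (t : ℕ) (u v : U) :
    0 ≤ (simulate H ε w x₀ a T t).x u v := by
  induction t with
  | zero => exact hx₀ u v
  | succ t ih =>
    simp only [simulate, iterStep]
    split_ifs
    · exact ih
    · exact div_nonneg ih (by linarith)

theorem central_x_le (hε : 0 < ε) (hε' : ε < 1 / 2) (hx₀ : ∀ u v, 0 ≤ x₀ u v) (t : ℕ) (u v : U) :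
    (central H ε w x₀ T t).x u v ≤ 2 ^ t * x₀ u v := by
  induction t with
  | zero => simp [central]
  | succ t ih =>
    have h0 := central_x_nonneg H ε w x₀ T hε' hx₀ t u v
    calc _ ≤ (central H ε w x₀ T t).x u v / (1 - ε) := iterStep_x_le_div hε hε' h0
      _ ≤ 2 * (central H ε w x₀ T t).x u v := div_one_sub_le hε' h0
      _ ≤ _ := by rw [pow_succ]; linarith

theorem simulate_x_le (hε : 0 < ε) (hε' : ε < 1 / 2) (hx₀ : ∀ u v, 0 ≤ x₀ u v) (t : ℕ)
    (u v : U) : (simulate H ε w x₀ a T t).x u v ≤ 2 ^ t * x₀ u v := by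
  induction t with
  | zero => simp [simulate]
  | succ t ih =>
    have h0 := simulate_x_nonneg H ε w x₀ a T hε' hx₀ t u v
    calc _ ≤ (simulate H ε w x₀ a T t).x u v / (1 - ε) := iterStep_x_le_div hε hε' h0
      _ ≤ 2 * (simulate H ε w x₀ a T t).x u v := div_one_sub_le hε' h0
      _ ≤ _ := by rw [pow_succ]; linarith

/-- The threshold value `τ` at `u` lies in the window in which the decisions of the two processes
in iteration `t` may differ. -/
def InWindow (m t : ℕ) (u : U) (τ : ℝ) : Prop :=
  incident H (central H ε w x₀ T t).x u < τ * w u ∧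
    τ * w u ≤ incident H (central H ε w x₀ T t).x u + 2 * bias m t * w u

open scoped Classical in
/-- The part of `∑ u, g u * x v u` (with the weights of the simulation at time `t`) contributed by
the vertices whose threshold, given by `τ`, falls in the critical window. -/
noncomputable def windowSum (g : U → ℝ) (t : ℕ) (τ : U → ℝ) (v : U) : ℝ :=
  ∑ u, (g u * (simulate H ε w x₀ a T t).x v u) * if InWindow H ε w x₀ T m t u (τ u) then 1 else 0

/-- The random choices are typical up to iteration `I`: the estimator is accurate on the weights of
the centralized process, and few thresholds fall in the critical windows. -/
structure Typical (I : ℕ) : Prop where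
  threshold : ∀ t < I, ∀ v, T v t ∈ Set.Icc (1 - 4 * ε) (1 - 2 * ε)
  sample : ∀ t ≤ I, ∀ v, |edgeSum (localCoeff H a v) (central H ε w x₀ T t).x v -
    edgeSum (globalCoeff H v) (central H ε w x₀ T t).x v| ≤ bias m t / 4 * w v
  window_global : ∀ t < I, ∀ v,
    edgeSum (globalCoeff H v) (simulate H ε w x₀ a T t).x v ≤ w v →
    windowSum H ε w x₀ a T (globalCoeff H v) t (fun u => T u t) v ≤ 2 * (bias m t / ε) * w v
  window_local : ∀ t < I, ∀ v,
    edgeSum (localCoeff H a v) (simulate H ε w x₀ a T t).x v ≤ w v →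
    windowSum H ε w x₀ a T (localCoeff H a v) t (fun u => T u t) v ≤ 2 * (bias m t / ε) * w v

open scoped Classical in
/-- The weight at `v` of the vertices frozen in the simulation but not in the centralized
process. -/
noncomputable def prematureSum (g : U → ℝ) (t : ℕ) (v : U) : ℝ :=
  ∑ u, if u ∈ (simulate H ε w x₀ a T t).frozen ∧ u ∉ (central H ε w x₀ T t).frozen
    then g u * (simulate H ε w x₀ a T t).x v u else 0

/-- The two processes are close at time `t`, seen through the coefficients `g` at `v`. -/
def CloseAt (g : U → ℝ) (t : ℕ) (v : U) : Prop :=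
  prematureSum H ε w x₀ a T g t v ≤ bias m t / (7 * ε) * w v ∧
    edgeSum g (central H ε w x₀ T t).x v - edgeSum g (simulate H ε w x₀ a T t).x v
      ≤ bias m t / 2 * w v

/-- The invariant of the comparison of the two processes. -/
structure Coupled (t : ℕ) : Prop where
  frozen_subset : ∀ v ∈ (central H ε w x₀ T t).frozen, v ∈ (simulate H ε w x₀ a T t).frozen
  x_le : ∀ u v, (simulate H ε w x₀ a T t).x u v ≤ (central H ε w x₀ T t).x u v
  close_global : ∀ v ∉ (simulate H ε w x₀ a T t).frozen,
    CloseAt H ε w x₀ a T (globalCoeff H v) t v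
  close_local : ∀ v ∉ (simulate H ε w x₀ a T t).frozen,
    CloseAt H ε w x₀ a T (localCoeff H a v) t v

variable {H ε w x₀ a T}

/-- The local sum of the simulation lies between `y - (1/4 + 1/2) * bias` and `y + bias / 4`,
relative to `w v`: a quarter is sampling error, a half is drift. Adding the bias makes the estimator
one-sided and leaves an error below twice the bias, which is the width of the critical window. -/
theorem Coupled.estimate_bounds {I t : ℕ} (hT : Typical H ε w x₀ a T I)
    (hc : Coupled H ε w x₀ a T t) (ht : t ≤ I) {v : U}
    (hv : v ∉ (simulate H ε w x₀ a T t).frozen) (hw : 0 < w v) :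
    incident H (central H ε w x₀ T t).x v
        ≤ estimate H w a t (simulate H ε w x₀ a T t).x v ∧
      estimate H w a t (simulate H ε w x₀ a T t).x v
        ≤ incident H (central H ε w x₀ T t).x v + 2 * bias m t * w v := by
  have h1 := abs_le.1 (hT.sample t ht v)
  have h2 := (hc.close_local v hv).2
  have h3 : edgeSum (localCoeff H a v) (simulate H ε w x₀ a T t).x v ≤
      edgeSum (localCoeff H a v) (central H ε w x₀ T t).x v :=
    edgeSum_mono (localCoeff_nonneg H a v) fun u => hc.x_le v u
  have h4 := mul_nonneg (bias_nonneg m t) hw.le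
  rw [incident_eq_edgeSum, estimate_eq]
  constructor <;> linarith [h1.1, h1.2]

/-- Only an edge from `v` to a prematurely frozen vertex creates new discrepancy; on every other
edge the old one is kept or divided by `1 - ε`. The argument needs only nonnegative coefficients, so
it serves both the full sum and the machine's rescaled sum. -/
theorem Coupled.closeAt_succ {t : ℕ} (hε : 0 < ε) (hε' : ε < 1 / 2) (hx₀ : ∀ u v, 0 ≤ x₀ u v)
    {g : U → ℝ} (hg : ∀ u, 0 ≤ g u) {v : U} (hw : 0 < w v)
    (hF' : ∀ v ∈ (central H ε w x₀ T (t + 1)).frozen,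
      v ∈ (simulate H ε w x₀ a T (t + 1)).frozen)
    (hx : ∀ u v, (simulate H ε w x₀ a T t).x u v ≤ (central H ε w x₀ T t).x u v)
    (hwin : ∀ u, u ∉ (simulate H ε w x₀ a T t).frozen →
      u ∈ (simulate H ε w x₀ a T (t + 1)).frozen → u ∉ (central H ε w x₀ T (t + 1)).frozen →
      InWindow H ε w x₀ T m t u (T u t))
    (hsum : windowSum H ε w x₀ a T g t (fun u => T u t) v ≤ 2 * (bias m t / ε) * w v)
    (hv : v ∉ (simulate H ε w x₀ a T (t + 1)).frozen)
    (hc : CloseAt H ε w x₀ a T g t v) : CloseAt H ε w x₀ a T g (t + 1) v := by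
  classical
  have hvC : v ∉ (central H ε w x₀ T (t + 1)).frozen := fun h => hv (hF' v h)
  have hs0 := simulate_x_nonneg H ε w x₀ a T hε' hx₀ t
  have hmonoC : ∀ u ∈ (central H ε w x₀ T t).frozen, u ∈ (central H ε w x₀ T (t + 1)).frozen :=
    fun u hu => mem_frozen_iterStep.2 (.inl hu)
  have hP : prematureSum H ε w x₀ a T g (t + 1) v ≤
      prematureSum H ε w x₀ a T g t v + windowSum H ε w x₀ a T g t (fun u => T u t) v := by
    unfold prematureSum windowSum
    rw [← Finset.sum_add_distrib]
    refine Finset.sum_le_sum fun u _ => ?_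
    have hgx : 0 ≤ g u * (simulate H ε w x₀ a T t).x v u := mul_nonneg (hg u) (hs0 v u)
    by_cases h1 : u ∈ (simulate H ε w x₀ a T (t + 1)).frozen ∧
        u ∉ (central H ε w x₀ T (t + 1)).frozen
    · have hxe : (simulate H ε w x₀ a T (t + 1)).x v u = (simulate H ε w x₀ a T t).x v u :=
        iterStep_x_of_mem (.inr h1.1)
      rw [if_pos h1, hxe]
      by_cases h2 : u ∈ (simulate H ε w x₀ a T t).frozen
      · rw [if_pos ⟨h2, fun h => h1.2 (hmonoC u h)⟩]
        have : 0 ≤ (g u * (simulate H ε w x₀ a T t).x v u) *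
            (if InWindow H ε w x₀ T m t u (T u t) then 1 else 0) := by
          split_ifs <;> simp [hgx]
        linarith
      · rw [if_neg (fun h => h2 h.1), if_pos (hwin u h2 h1.1 h1.2)]
        linarith
    · rw [if_neg h1]
      split_ifs <;> simp [hgx]
  have hP' : prematureSum H ε w x₀ a T g (t + 1) v ≤ bias m (t + 1) / (7 * ε) * w v := by
    -- The constant 7 solves `1/7 + 2 = 15/7`: old premature weight plus the new window weight is
    -- exactly the next bound.
    have e : bias m (t + 1) / (7 * ε) * w v =
        bias m t / (7 * ε) * w v + 2 * (bias m t / ε) * w v := by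
      rw [bias_succ]; field_simp; ring
    linarith [hc.1]
  refine ⟨hP', ?_⟩
  have hD : edgeSum g (central H ε w x₀ T (t + 1)).x v -
      edgeSum g (simulate H ε w x₀ a T (t + 1)).x v ≤
      2 * (edgeSum g (central H ε w x₀ T t).x v - edgeSum g (simulate H ε w x₀ a T t).x v) +
      2 * ε * prematureSum H ε w x₀ a T g (t + 1) v := by
    unfold edgeSum prematureSum
    rw [← Finset.sum_sub_distrib, ← Finset.sum_sub_distrib, Finset.mul_sum, Finset.mul_sum,
      ← Finset.sum_add_distrib]
    refine Finset.sum_le_sum fun u _ => ?_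
    have hd : 0 ≤ (central H ε w x₀ T t).x v u - (simulate H ε w x₀ a T t).x v u :=
      sub_nonneg.2 (hx v u)
    have hgd := mul_nonneg (hg u) hd
    have h2 := mul_le_mul_of_nonneg_left (div_one_sub_le hε' hd) (hg u)
    by_cases hS : u ∈ (simulate H ε w x₀ a T (t + 1)).frozen
    · have hxS : (simulate H ε w x₀ a T (t + 1)).x v u = (simulate H ε w x₀ a T t).x v u :=
        iterStep_x_of_mem (.inr hS)
      by_cases hC : u ∈ (central H ε w x₀ T (t + 1)).frozen
      · have hxC : (central H ε w x₀ T (t + 1)).x v u = (central H ε w x₀ T t).x v u :=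
          iterStep_x_of_mem (.inr hC)
        rw [if_neg (fun h => h.2 hC), hxS, hxC]
        linarith
      · have hxC : (central H ε w x₀ T (t + 1)).x v u = (central H ε w x₀ T t).x v u / (1 - ε) :=
          iterStep_x_of_notMem hvC hC
        rw [if_pos ⟨hS, hC⟩, hxS, hxC]
        -- With `c`, `s` the two weights, the new gap is `(c - s)/(1 - ε)` plus `s/(1 - ε) - s = ε
        -- s/(1 - ε) ≤ 2 ε s`.
        have h3 := mul_le_mul_of_nonneg_left (div_one_sub_le hε' (hs0 v u)) hε.le
        have h4 : (simulate H ε w x₀ a T t).x v u / (1 - ε) - (simulate H ε w x₀ a T t).x v u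
            = ε * ((simulate H ε w x₀ a T t).x v u / (1 - ε)) := by
          have : (1 - ε) ≠ 0 := by linarith
          field_simp; ring
        have h5 := mul_le_mul_of_nonneg_left (h4.trans_le h3) (hg u)
        rw [sub_div] at h2
        linarith
    · have hxS : (simulate H ε w x₀ a T (t + 1)).x v u =
          (simulate H ε w x₀ a T t).x v u / (1 - ε) := iterStep_x_of_notMem hv hS
      have hxC : (central H ε w x₀ T (t + 1)).x v u = (central H ε w x₀ T t).x v u / (1 - ε) :=
        iterStep_x_of_notMem hvC fun h => hS (hF' u h)
      rw [if_neg (fun h => hS h.1), hxS, hxC]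
      rw [sub_div] at h2
      linarith
  -- In units of `bias m t`, doubling half the bias gives 1 and the premature weight gives `30/7`;
  -- together they stay below `15/2`, half the next bias.
  have h6 : 2 * ε * prematureSum H ε w x₀ a T g (t + 1) v ≤
      2 * ε * (bias m (t + 1) / (7 * ε) * w v) :=
    mul_le_mul_of_nonneg_left hP' (by positivity)
  have h7 : 2 * ε * (bias m (t + 1) / (7 * ε) * w v) = 2 / 7 * (bias m (t + 1) * w v) := by
    field_simp
  have h8 := hc.2
  have h9 := mul_nonneg (bias_nonneg m t) hw.le
  rw [bias_succ] at h6 h7 ⊢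
  linarith

theorem coupled_of_typical {I : ℕ} (hε : 0 < ε) (hε' : ε < 1 / 2) (hx₀ : ∀ u v, 0 ≤ x₀ u v)
    (hw : ∀ v, 0 < w v) (hT : Typical H ε w x₀ a T I) {t : ℕ} (ht : t ≤ I) :
    Coupled H ε w x₀ a T t := by
  induction t with
  | zero =>
    have hclose : ∀ (g : U → ℝ) (v : U), CloseAt H ε w x₀ a T g 0 v := fun g v => by
      have h := bias_nonneg m 0
      have hw := (hw v).le
      constructor
      · have : prematureSum H ε w x₀ a T g 0 v = 0 := by
          simp [prematureSum, simulate]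
        rw [this]; positivity
      · simp only [central, simulate, sub_self]; positivity
    exact ⟨by simp [central], by simp [central, simulate], fun v _ => hclose _ v,
      fun v _ => hclose _ v⟩
  | succ t ih =>
    have hc := ih (by omega)
    have htI : t < I := by omega
    have hest : ∀ v, v ∉ (simulate H ε w x₀ a T t).frozen → _ :=
      fun v hv => hc.estimate_bounds hT htI.le hv (hw v)
    have hF' : ∀ v ∈ (central H ε w x₀ T (t + 1)).frozen,
        v ∈ (simulate H ε w x₀ a T (t + 1)).frozen := by
      intro v hv
      rcases mem_frozen_iterStep.1 hv with h | h
      · exact mem_frozen_iterStep.2 (.inl (hc.frozen_subset v h))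
      · by_cases hS : v ∈ (simulate H ε w x₀ a T t).frozen
        · exact mem_frozen_iterStep.2 (.inl hS)
        · exact mem_frozen_iterStep.2 (.inr (h.trans (hest v hS).1))
    have hwin : ∀ u, u ∉ (simulate H ε w x₀ a T t).frozen →
        u ∈ (simulate H ε w x₀ a T (t + 1)).frozen → u ∉ (central H ε w x₀ T (t + 1)).frozen →
        InWindow H ε w x₀ T m t u (T u t) := by
      intro u h1 h2 h3
      have h4 := (mem_frozen_iterStep.1 h2).resolve_left h1
      have h5 := (not_or.1 (fun h => h3 (mem_frozen_iterStep.2 h))).2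
      exact ⟨not_le.1 h5, h4.trans (hest u h1).2⟩
    have hxs : ∀ u v, (simulate H ε w x₀ a T (t + 1)).x u v ≤
        (central H ε w x₀ T (t + 1)).x u v := by
      intro u v
      by_cases h : u ∈ (simulate H ε w x₀ a T (t + 1)).frozen ∨
          v ∈ (simulate H ε w x₀ a T (t + 1)).frozen
      · calc _ = (simulate H ε w x₀ a T t).x u v := iterStep_x_of_mem h
          _ ≤ (central H ε w x₀ T t).x u v := hc.x_le u v
          _ ≤ _ := le_iterStep_x hε hε' (central_x_nonneg H ε w x₀ T hε' hx₀ t u v)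
      · obtain ⟨h1, h2⟩ := not_or.1 h
        calc _ = (simulate H ε w x₀ a T t).x u v / (1 - ε) := iterStep_x_of_notMem h1 h2
          _ ≤ (central H ε w x₀ T t).x u v / (1 - ε) :=
            div_le_div_of_nonneg_right (hc.x_le u v) (by linarith)
          _ = _ := (iterStep_x_of_notMem (fun h => h1 (hF' u h)) fun h => h2 (hF' v h)).symm
    -- A vertex that fails the freezing test has estimator below `w v`. This discharges the premises
    -- of the window bounds in `Typical`, which are only available for sums at most `w v`.
    have hsurv : ∀ v, v ∉ (simulate H ε w x₀ a T (t + 1)).frozen →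
        v ∉ (simulate H ε w x₀ a T t).frozen ∧
        edgeSum (globalCoeff H v) (simulate H ε w x₀ a T t).x v ≤ w v ∧
        edgeSum (localCoeff H a v) (simulate H ε w x₀ a T t).x v ≤ w v := by
      intro v hv
      obtain ⟨h1, h2⟩ := not_or.1 (fun h => hv (mem_frozen_iterStep.2 h))
      have h3 := (hest v h1).1
      have h4 := edgeSum_mono (globalCoeff_nonneg H v) fun u => hc.x_le v u
      have h5 := (hT.threshold t htI v).2
      have h6 : T v t * w v ≤ 1 * w v :=
        mul_le_mul_of_nonneg_right (by linarith) (hw v).le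
      have h7 := mul_nonneg (bias_nonneg m t) (hw v).le
      rw [not_le] at h2
      rw [incident_eq_edgeSum] at h3
      refine ⟨h1, by linarith, ?_⟩
      rw [estimate_eq] at h2
      linarith
    refine ⟨hF', hxs, fun v hv => ?_, fun v hv => ?_⟩
    · obtain ⟨h1, h2, h3⟩ := hsurv v hv
      exact Coupled.closeAt_succ hε hε' hx₀ (globalCoeff_nonneg H v) (hw v) hF' hc.x_le
        hwin (hT.window_global t htI v h2) hv (hc.close_global v h1)
    · obtain ⟨h1, h2, h3⟩ := hsurv v hv
      exact Coupled.closeAt_succ hε hε' hx₀ (localCoeff_nonneg H a v) (hw v) hF' hc.x_le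
        hwin (hT.window_local t htI v h3) hv (hc.close_local v h1)

theorem edgeSum_central_succ_of_frozen {t : ℕ} {v : U} (g : U → ℝ)
    (hv : v ∈ (central H ε w x₀ T (t + 1)).frozen) :
    edgeSum g (central H ε w x₀ T (t + 1)).x v = edgeSum g (central H ε w x₀ T t).x v :=
  Finset.sum_congr rfl fun u _ => by
    rw [show (central H ε w x₀ T (t + 1)).x v u = (central H ε w x₀ T t).x v u from
      iterStep_x_of_mem (.inl hv)]

theorem edgeSum_simulate_succ_of_frozen {t : ℕ} {v : U} (g : U → ℝ)
    (hv : v ∈ (simulate H ε w x₀ a T (t + 1)).frozen) :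
    edgeSum g (simulate H ε w x₀ a T (t + 1)).x v = edgeSum g (simulate H ε w x₀ a T t).x v :=
  Finset.sum_congr rfl fun u _ => by
    rw [show (simulate H ε w x₀ a T (t + 1)).x v u = (simulate H ε w x₀ a T t).x v u from
      iterStep_x_of_mem (.inl hv)]

/-- What is known at time `t` about a vertex frozen by the simulation: the sums of the simulation no
longer change, and those of the centralized process have not grown much. -/
theorem frozen_bounds {I : ℕ} (hε : 0 < ε) (hε' : ε < 1 / 2) (hx₀ : ∀ u v, 0 ≤ x₀ u v)
    (hw : ∀ v, 0 < w v) (hT : Typical H ε w x₀ a T I) {t : ℕ} (ht : t ≤ I) {v : U}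
    (hv : v ∈ (simulate H ε w x₀ a T t).frozen) :
    ∃ s < t, v ∉ (simulate H ε w x₀ a T s).frozen ∧
      (1 - 4 * ε) * w v ≤ estimate H w a s (simulate H ε w x₀ a T s).x v ∧
      (∀ g, edgeSum g (simulate H ε w x₀ a T t).x v = edgeSum g (simulate H ε w x₀ a T s).x v) ∧
      edgeSum (globalCoeff H v) (central H ε w x₀ T s).x v ≤
        edgeSum (globalCoeff H v) (central H ε w x₀ T t).x v ∧
      (edgeSum (globalCoeff H v) (central H ε w x₀ T t).x v ≤
          edgeSum (globalCoeff H v) (central H ε w x₀ T s).x v ∨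
        edgeSum (globalCoeff H v) (central H ε w x₀ T t).x v ≤ (1 - ε) * w v) := by
  have hC0 := central_x_nonneg H ε w x₀ T hε' hx₀
  induction t with
  | zero => simp [simulate] at hv
  | succ t ih =>
    have htI : t < I := by omega
    have hmono : edgeSum (globalCoeff H v) (central H ε w x₀ T t).x v ≤
        edgeSum (globalCoeff H v) (central H ε w x₀ T (t + 1)).x v :=
      edgeSum_mono (globalCoeff_nonneg H v) fun u => le_iterStep_x hε hε' (hC0 t v u)
    have hgrow : edgeSum (globalCoeff H v) (central H ε w x₀ T (t + 1)).x v ≤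
          edgeSum (globalCoeff H v) (central H ε w x₀ T t).x v ∨
        edgeSum (globalCoeff H v) (central H ε w x₀ T (t + 1)).x v ≤ (1 - ε) * w v := by
      by_cases hC : v ∈ (central H ε w x₀ T (t + 1)).frozen
      · exact .inl (edgeSum_central_succ_of_frozen _ hC).le
      · right
        have h1 := (not_or.1 (fun h => hC (mem_frozen_iterStep.2 h))).2
        rw [not_le, incident_eq_edgeSum] at h1
        have h2 : edgeSum (globalCoeff H v) (central H ε w x₀ T (t + 1)).x v ≤
            edgeSum (globalCoeff H v) (central H ε w x₀ T t).x v / (1 - ε) := by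
          unfold edgeSum
          rw [Finset.sum_div]
          refine Finset.sum_le_sum fun u _ => ?_
          rw [mul_div_assoc]
          exact mul_le_mul_of_nonneg_left (iterStep_x_le_div hε hε' (hC0 t v u))
            (globalCoeff_nonneg H v u)
        -- An active vertex has `y < (1 - 2ε) w`, and `1 - 2ε ≤ (1 - ε)²`.
        refine h2.trans ?_
        rw [div_le_iff₀ (by linarith)]
        have h3 := (hT.threshold t htI v).2
        have h4 : T v t * w v ≤ (1 - 2 * ε) * w v := mul_le_mul_of_nonneg_right h3 (hw v).le
        nlinarith [hw v, mul_pos hε hε]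
    by_cases hS : v ∈ (simulate H ε w x₀ a T t).frozen
    · obtain ⟨s, hst, h1, h2, h3, h4, h5⟩ := ih (by omega) hS
      refine ⟨s, by omega, h1, h2, fun g => ?_, h4.trans hmono, ?_⟩
      · rw [edgeSum_simulate_succ_of_frozen g hv, h3]
      · rcases hgrow with h | h
        · exact h5.imp h.trans h.trans
        · exact .inr h
    · refine ⟨t, by omega, hS, ?_, fun g => edgeSum_simulate_succ_of_frozen g hv, hmono, hgrow⟩
      have h1 := (mem_frozen_iterStep.1 hv).resolve_left hS
      exact (mul_le_mul_of_nonneg_right (hT.threshold t htI v).1 (hw v).le).trans h1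

/-- For typical random choices, the two processes stay close. -/
theorem abs_sub_le_of_typical {I : ℕ} (hε : 0 < ε) (hε' : ε < 1 / 2) (hx₀ : ∀ u v, 0 ≤ x₀ u v)
    (hw : ∀ v, 0 < w v) (hT : Typical H ε w x₀ a T I) (hb : bias m I ≤ ε) {t : ℕ} (ht : t ≤ I)
    (v : U) :
    |incident H (central H ε w x₀ T t).x v - estimate H w a t (simulate H ε w x₀ a T t).x v|
        ≤ 6 * ε * w v ∧
      |incident H (central H ε w x₀ T t).x v - incident H (simulate H ε w x₀ a T t).x v|
        ≤ 6 * ε * w v := by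
  have hwv := hw v
  have hεw := mul_pos hε hwv
  have key : ∀ s ≤ I, v ∉ (simulate H ε w x₀ a T s).frozen → 0 ≤ bias m s * w v ∧
      bias m s * w v ≤ ε * w v ∧ _ ∧ _ ∧ _ := fun s hs hvs =>
    have hc := coupled_of_typical hε hε' hx₀ hw hT hs
    ⟨mul_nonneg (bias_nonneg m s) hwv.le,
      mul_le_mul_of_nonneg_right ((bias_mono m hs).trans hb) hwv.le,
      hc.estimate_bounds hT hs hvs hwv, (hc.close_global v hvs).2,
      edgeSum_mono (globalCoeff_nonneg H v) fun u => hc.x_le v u⟩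
  simp only [incident_eq_edgeSum] at key ⊢
  rw [abs_le, abs_le]
  by_cases hv : v ∈ (simulate H ε w x₀ a T t).frozen
  · obtain ⟨s, hst, h1, h2, h3, h4, h5⟩ := frozen_bounds hε hε' hx₀ hw hT ht hv
    obtain ⟨k0, k1, ⟨k2, k3⟩, k4, k5⟩ := key s (by omega) h1
    have hbt : bias m t * w v ≤ ε * w v :=
      mul_le_mul_of_nonneg_right ((bias_mono m ht).trans hb) hwv.le
    have hbt' : 0 ≤ bias m t * w v := mul_nonneg (bias_nonneg m t) hwv.le
    rw [estimate_eq] at h2 k2 k3 ⊢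
    rw [h3, h3]
    -- If the centralized sum grew after the freezing time `s`, it is at most `(1 - ε) w`, while the
    -- estimator at `s` was at least `(1 - 4ε) w`. The loss of 3ε plus at most `5/2` biases, each at
    -- most ε, stays below 6ε.
    rcases h5 with h5 | h5 <;> refine ⟨⟨?_, ?_⟩, ?_, ?_⟩ <;> linarith
  · obtain ⟨k0, k1, ⟨k2, k3⟩, k4, k5⟩ := key t ht hv
    refine ⟨⟨?_, ?_⟩, ?_, ?_⟩ <;> linarith

end Runs

end Deterministic

/-! ### Chernoff bounds and resampling in product measures. -/

section Probability

open MeasureTheory ProbabilityTheory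

theorem exp_mul_indicator_le {Ω : Type*} (J : Set Ω) {r : ℝ} (hr : |r| ≤ 1) (x : Ω) :
    Real.exp (r * J.indicator (fun _ => (1 : ℝ)) x)
      ≤ 1 + (r + r ^ 2) * J.indicator (fun _ => (1 : ℝ)) x := by
  by_cases hx : x ∈ J
  · have := (abs_le.1 (Real.abs_exp_sub_one_sub_id_le hr)).2
    simp only [hx, Set.indicator_of_mem, mul_one]
    linarith
  · simp [hx]

theorem integrable_exp_mul_indicator {Ω : Type*} [MeasurableSpace Ω] (ν : Measure Ω)
    [IsProbabilityMeasure ν] {J : Set Ω} (hJ : MeasurableSet J) (r : ℝ) :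
    Integrable (fun x => Real.exp (r * J.indicator (fun _ => (1 : ℝ)) x)) ν := by
  refine Integrable.of_bound (C := Real.exp |r|) ?_ (ae_of_all _ fun x => ?_)
  · exact (Real.measurable_exp.comp
      ((measurable_const.indicator hJ).const_mul r)).aestronglyMeasurable
  · rw [Real.norm_eq_abs, Real.abs_exp, Real.exp_le_exp]
    by_cases hx : x ∈ J <;> simp [hx, le_abs_self]

theorem integral_exp_mul_indicator_le {Ω : Type*} [MeasurableSpace Ω] (ν : Measure Ω)
    [IsProbabilityMeasure ν] {J : Set Ω} (hJ : MeasurableSet J) {r : ℝ} (hr : |r| ≤ 1) :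
    ∫ x, Real.exp (r * J.indicator (fun _ => (1 : ℝ)) x) ∂ν
      ≤ Real.exp ((r + r ^ 2) * ν.real J) := by
  have hi : Integrable (J.indicator fun _ => (1 : ℝ)) ν :=
    (integrable_const 1).indicator hJ
  calc _ ≤ ∫ x, (1 + (r + r ^ 2) * J.indicator (fun _ => (1 : ℝ)) x) ∂ν :=
        integral_mono (integrable_exp_mul_indicator ν hJ r)
          ((integrable_const 1).add (hi.const_mul _)) (exp_mul_indicator_le J hr)
    _ = (r + r ^ 2) * ν.real J + 1 := by
        rw [integral_add (integrable_const 1) (hi.const_mul _), integral_const_mul,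
          integral_indicator hJ]
        simp [add_comm]
    _ ≤ _ := Real.add_one_le_exp _

theorem exp_sum_eq_prod {ι Ω : Type*} [Fintype ι] (c : ι → ℝ) (J : ι → Set Ω) (θ : ℝ) (ω : ι → Ω) :
    Real.exp (θ * ∑ i, c i * (J i).indicator (fun _ => (1 : ℝ)) (ω i)) =
      ∏ i, Real.exp ((θ * c i) * (J i).indicator (fun _ => (1 : ℝ)) (ω i)) := by
  rw [← Real.exp_sum, Finset.mul_sum]
  simp only [mul_assoc]

variable {ι Ω : Type*} [Fintype ι] [MeasurableSpace Ω] (ν : Measure Ω) [IsProbabilityMeasure ν]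

theorem integrable_exp_sum_indicator (c : ι → ℝ) {J : ι → Set Ω} (hJ : ∀ i, MeasurableSet (J i))
    (θ : ℝ) : Integrable (fun ω : ι → Ω => Real.exp (θ * ∑ i, c i *
      (J i).indicator (fun _ => (1 : ℝ)) (ω i))) (Measure.pi fun _ => ν) := by
  simp only [exp_sum_eq_prod]
  exact Integrable.fintype_prod fun i => integrable_exp_mul_indicator ν (hJ i) _

/-- Independence factors the moment generating function, and `exp r ≤ 1 + r + r²` for `|r| ≤ 1`
bounds each factor. The quadratic terms are linearized by `c i² ≤ M * c i`. The sign of `θ` is left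
free so that both tails follow. -/
theorem mgf_sum_indicator_le {c : ι → ℝ} {J : ι → Set Ω} (hJ : ∀ i, MeasurableSet (J i))
    {θ M μ : ℝ} (hc : ∀ i, 0 ≤ c i) (hcM : ∀ i, c i ≤ M)
    (hM : 0 ≤ M) (hθ : |θ| * M ≤ 1)
    (hμ : ∑ i, c i * ν.real (J i) ≤ μ) :
    mgf (fun ω : ι → Ω => ∑ i, c i * (J i).indicator (fun _ => (1 : ℝ)) (ω i))
      (Measure.pi fun _ => ν) θ ≤
      Real.exp (θ * ∑ i, c i * ν.real (J i) + θ ^ 2 * M * μ) := by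
  have hr : ∀ i, |θ * c i| ≤ 1 := fun i => by
    rw [abs_mul, abs_of_nonneg (hc i)]
    exact (mul_le_mul_of_nonneg_left (hcM i) (abs_nonneg θ)).trans hθ
  unfold mgf
  simp only [exp_sum_eq_prod]
  rw [integral_fintype_prod_eq_prod (μ := fun _ : ι => ν)
    (fun i x => Real.exp ((θ * c i) * (J i).indicator (fun _ => (1 : ℝ)) x))]
  calc _ ≤ ∏ i, Real.exp ((θ * c i + (θ * c i) ^ 2) * ν.real (J i)) :=
        Finset.prod_le_prod (fun i _ => integral_nonneg fun x => (Real.exp_pos _).le)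
          fun i _ => integral_exp_mul_indicator_le ν (hJ i) (hr i)
    _ = Real.exp (∑ i, (θ * c i + (θ * c i) ^ 2) * ν.real (J i)) := (Real.exp_sum _ _).symm
    _ ≤ _ := by
        rw [Real.exp_le_exp]
        have h1 : ∑ i, (θ * c i + (θ * c i) ^ 2) * ν.real (J i) ≤
            ∑ i, (θ * (c i * ν.real (J i)) + θ ^ 2 * M * (c i * ν.real (J i))) := by
          refine Finset.sum_le_sum fun i _ => ?_
          have : c i * (c i * ν.real (J i)) ≤ M * (c i * ν.real (J i)) :=
            mul_le_mul_of_nonneg_right (hcM i) (mul_nonneg (hc i) measureReal_nonneg)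
          nlinarith [mul_le_mul_of_nonneg_left this (sq_nonneg θ)]
        rw [Finset.sum_add_distrib, ← Finset.mul_sum, ← Finset.mul_sum] at h1
        have := mul_le_mul_of_nonneg_left hμ (mul_nonneg (sq_nonneg θ) hM)
        linarith

/-- A Chernoff bound for the upper tail of a weighted sum of independent indicators. -/
theorem measureReal_le_sum_indicator_le {c : ι → ℝ} {J : ι → Set Ω}
    (hJ : ∀ i, MeasurableSet (J i)) {θ M μ : ℝ} (hc : ∀ i, 0 ≤ c i) (hcM : ∀ i, c i ≤ M)
    (hM : 0 ≤ M) (hθ₀ : 0 ≤ θ) (hθ : θ * M ≤ 1) (hμ : ∑ i, c i * ν.real (J i) ≤ μ) (b : ℝ) :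
    (Measure.pi fun _ : ι => ν).real
      {ω | b ≤ ∑ i, c i * (J i).indicator (fun _ => (1 : ℝ)) (ω i)} ≤
      Real.exp (-(θ * (b - μ)) + θ ^ 2 * M * μ) := by
  refine (measure_ge_le_exp_mul_mgf b hθ₀ (integrable_exp_sum_indicator ν c hJ θ)).trans ?_
  refine (mul_le_mul_of_nonneg_left (mgf_sum_indicator_le ν hJ hc hcM hM
    (by rwa [abs_of_nonneg hθ₀]) hμ) (Real.exp_pos _).le).trans ?_
  rw [← Real.exp_add, Real.exp_le_exp]
  linarith [mul_le_mul_of_nonneg_left hμ hθ₀]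

/-- A Chernoff bound for the lower tail of a weighted sum of independent indicators. -/
theorem measureReal_sum_indicator_le_le {c : ι → ℝ} {J : ι → Set Ω}
    (hJ : ∀ i, MeasurableSet (J i)) {θ M μ : ℝ} (hc : ∀ i, 0 ≤ c i) (hcM : ∀ i, c i ≤ M)
    (hM : 0 ≤ M) (hθ₀ : 0 ≤ θ) (hθ : θ * M ≤ 1) (hμ : ∑ i, c i * ν.real (J i) ≤ μ) (b : ℝ) :
    (Measure.pi fun _ : ι => ν).real
      {ω | ∑ i, c i * (J i).indicator (fun _ => (1 : ℝ)) (ω i) ≤ b} ≤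
      Real.exp (-(θ * (∑ i, c i * ν.real (J i) - b)) + θ ^ 2 * M * μ) := by
  refine (measure_le_le_exp_mul_mgf b (neg_nonpos.2 hθ₀)
    (integrable_exp_sum_indicator ν c hJ (-θ))).trans ?_
  refine (mul_le_mul_of_nonneg_left (mgf_sum_indicator_le ν hJ hc hcM hM
    (by rwa [abs_neg, abs_of_nonneg hθ₀]) hμ) (Real.exp_pos _).le).trans ?_
  rw [← Real.exp_add, Real.exp_le_exp]
  linarith

theorem measurePreserving_update {κ : Type*} [Fintype κ] [DecidableEq κ] (k : κ) :
    MeasurePreserving (fun p : (κ → Ω) × Ω => Function.update p.1 k p.2)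
      ((Measure.pi fun _ => ν).prod ν) (Measure.pi fun _ => ν) where
  measurable := measurable_update'
  map_eq := by
    refine (Measure.pi_eq fun s hs => ?_).symm
    rw [Measure.map_apply measurable_update' (MeasurableSet.univ_pi hs)]
    -- The overwritten coordinate is unconstrained in the first factor; its condition moves to the
    -- fresh copy.
    have : (fun p : (κ → Ω) × Ω => Function.update p.1 k p.2) ⁻¹' Set.univ.pi s =
        (Set.univ.pi (Function.update s k Set.univ)) ×ˢ s k := by
      ext p
      simp only [Set.mem_preimage, Set.mem_pi, Set.mem_univ, true_implies, Set.mem_prod]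
      constructor
      · intro h
        refine ⟨fun j => ?_, by simpa using h k⟩
        by_cases hj : j = k
        · subst hj; simp
        · simpa [hj] using h j
      · rintro ⟨h, h'⟩ j
        by_cases hj : j = k
        · subst hj; simpa using h'
        · simpa [hj] using h j
    rw [this, Measure.prod_prod, Measure.pi_pi, ← Finset.mul_prod_erase _ _ (Finset.mem_univ k),
      ← Finset.mul_prod_erase _ (fun i => ν (s i)) (Finset.mem_univ k)]
    rw [Function.update_self, measure_univ, one_mul, mul_comm]
    congr 1
    refine Finset.prod_congr rfl fun j hj => ?_
    rw [Function.update_of_ne (Finset.ne_of_mem_erase hj)]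

theorem measurePreserving_update_pi {κ : Type*} [Fintype κ] [DecidableEq κ] (k : κ) :
    MeasurePreserving
      (fun p : (ι → κ → Ω) × (ι → Ω) => fun i => Function.update (p.1 i) k (p.2 i))
      ((Measure.pi fun _ => Measure.pi fun _ => ν).prod (Measure.pi fun _ => ν))
      (Measure.pi fun _ => Measure.pi fun _ => ν) :=
  (measurePreserving_pi _ _ fun _ : ι => measurePreserving_update ν k).comp
    ((measurePreserving_arrowProdEquivProdArrow (κ → Ω) Ω ι (fun _ => Measure.pi fun _ => ν)
      (fun _ => ν)).symm (MeasurableEquiv.arrowProdEquivProdArrow (κ → Ω) Ω ι))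

theorem measureReal_prod_le_of_forall_left {α β : Type*} [MeasurableSpace α] [MeasurableSpace β]
    (P : Measure α) (Q : Measure β) [IsProbabilityMeasure P] [IsProbabilityMeasure Q]
    {E : Set (α × β)} (hE : MeasurableSet E) {p : ℝ} (h : ∀ a, Q.real {b | (a, b) ∈ E} ≤ p) :
    (P.prod Q).real E ≤ p := by
  rcases isEmpty_or_nonempty α with hα | ⟨⟨a₀⟩⟩
  · exact absurd (measure_univ (μ := P)) (by simp [Set.eq_empty_of_isEmpty])
  have hp : 0 ≤ p := measureReal_nonneg.trans (h a₀)
  refine ENNReal.toReal_le_of_le_ofReal hp ?_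
  rw [Measure.prod_apply hE]
  calc _ ≤ ∫⁻ _, ENNReal.ofReal p ∂P := lintegral_mono fun a => by
        rw [← ENNReal.ofReal_toReal (measure_ne_top Q _)]
        exact ENNReal.ofReal_le_ofReal (h a)
    _ = _ := by simp

theorem measureReal_prod_le_of_forall_right {α β : Type*} [MeasurableSpace α]
    [MeasurableSpace β] (P : Measure α) (Q : Measure β) [IsProbabilityMeasure P]
    [IsProbabilityMeasure Q] {E : Set (α × β)} (hE : MeasurableSet E) {p : ℝ}
    (h : ∀ b, P.real {a | (a, b) ∈ E} ≤ p) : (P.prod Q).real E ≤ p := by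
  have h1 : (Q.prod P).real (Prod.swap ⁻¹' E) ≤ p :=
    measureReal_prod_le_of_forall_left Q P (measurable_swap hE) h
  rwa [← Measure.prod_swap (μ := Q) (ν := P), measureReal_def,
    Measure.map_apply measurable_swap hE]

/-- If an event is unlikely after resampling the `k`-th entries of all rows, whatever the other
entries are, then it is unlikely. -/
theorem measureReal_le_of_resample {κ β : Type*} [Fintype κ] [DecidableEq κ] [MeasurableSpace β]
    (Q : Measure β) [IsProbabilityMeasure Q] (k : κ) {E : Set ((ι → κ → Ω) × β)}
    (hE : MeasurableSet E) {p : ℝ}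
    (h : ∀ (T : ι → κ → Ω) (b : β), (Measure.pi fun _ : ι => ν).real
      {τ | ((fun i => Function.update (T i) k (τ i)), b) ∈ E} ≤ p) :
    ((Measure.pi fun _ => Measure.pi fun _ => ν).prod Q).real E ≤ p := by
  refine measureReal_prod_le_of_forall_right _ _ hE fun b => ?_
  have hmp := measurePreserving_update_pi (ι := ι) ν k
  have hEb : MeasurableSet {T | (T, b) ∈ E} := measurable_prodMk_right hE
  rw [measureReal_def, ← hmp.measure_preimage hEb.nullMeasurableSet]
  exact measureReal_prod_le_of_forall_left _ _ (hmp.measurable hEb) fun T => h T b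

end Probability

/-! ### Measurability of the runs in the random choices. -/

section Measurability

open MeasureTheory ProbabilityTheory

theorem measurable_localCoeff {U Ω : Type*} [MeasurableSpace Ω] (H : SimpleGraph U) {m : ℕ} {a : Ω → U → Fin m}
    (ha : ∀ u, Measurable fun ω => a ω u) (v u : U) :
    Measurable fun ω => localCoeff H (a ω) v u := by
  classical
  refine Measurable.ite ?_ measurable_const measurable_const
  exact (MeasurableSet.const _).inter (measurableSet_eq_fun (ha u) (ha v))

theorem measurable_thresholds {U Ω : Type*} [MeasurableSpace Ω] {I : ℕ} {T : Ω → U → Fin I → ℝ}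
    (hT : ∀ v t, Measurable fun ω => T ω v t) (v : U) (t : ℕ) :
    Measurable fun ω => thresholds (T ω) v t := by
  unfold thresholds
  split_ifs
  · exact hT _ _
  · exact measurable_const

variable {U Ω : Type*} [Fintype U] [MeasurableSpace Ω]

/-- The status of a run depends measurably on the random choices. -/
structure MeasurableRun (s : Ω → RunState U) : Prop where
  frozen : ∀ v, MeasurableSet {ω | v ∈ (s ω).frozen}
  x : ∀ u v, Measurable fun ω => (s ω).x u v

theorem MeasurableRun.iterStep {ε : ℝ} {s : Ω → RunState U}
    {test : Ω → (U → U → ℝ) → U → Prop} (hs : MeasurableRun s)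
    (ht : ∀ v, MeasurableSet {ω | test ω (s ω).x v}) :
    MeasurableRun fun ω => iterStep ε (test ω) (s ω) := by
  classical
  have hF : ∀ v, MeasurableSet {ω | v ∈ (MWVC.iterStep ε (test ω) (s ω)).frozen} := fun v => by
    simp only [mem_frozen_iterStep]
    exact (hs.frozen v).union (ht v)
  exact ⟨hF, fun u v => Measurable.ite ((hF u).union (hF v)) (hs.x u v) ((hs.x u v).div_const _)⟩

theorem MeasurableRun.edgeSum {s : Ω → RunState U} (hs : MeasurableRun s) {g : Ω → U → ℝ}
    (hg : ∀ u, Measurable fun ω => g ω u) (v : U) :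
    Measurable fun ω => edgeSum (g ω) (s ω).x v :=
  Finset.measurable_sum _ fun u _ => (hg u).mul (hs.x v u)

variable {H : SimpleGraph U} {ε : ℝ} {w : U → ℝ} {x₀ : U → U → ℝ} {m : ℕ} {a : Ω → U → Fin m}
  {T : Ω → U → ℕ → ℝ}

theorem measurableRun_central (hT : ∀ v t, Measurable fun ω => T ω v t) (t : ℕ) :
    MeasurableRun fun ω => central H ε w x₀ (T ω) t := by
  induction t with
  | zero => exact ⟨fun v => by simp [central], fun u v => measurable_const⟩
  | succ t ih =>
    refine ih.iterStep fun v => ?_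
    simp only [incident_eq_edgeSum]
    exact measurableSet_le ((hT v t).mul_const _) 
      (ih.edgeSum (g := fun _ => globalCoeff H v) (fun u => measurable_const) v)

theorem measurableRun_simulate (ha : ∀ u, Measurable fun ω => a ω u)
    (hT : ∀ v t, Measurable fun ω => T ω v t) (t : ℕ) :
    MeasurableRun fun ω => simulate H ε w x₀ (a ω) (T ω) t := by
  induction t with
  | zero => exact ⟨fun v => by simp [simulate], fun u v => measurable_const⟩
  | succ t ih =>
    refine ih.iterStep fun v => ?_
    simp only [estimate_eq]
    exact measurableSet_le ((hT v t).mul_const _)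
      ((ih.edgeSum (measurable_localCoeff H ha v) v).const_add _)

theorem measurableSet_inWindow (hT : ∀ v t, Measurable fun ω => T ω v t) (t : ℕ) (u : U)
    {τ : Ω → ℝ} (hτ : Measurable τ) :
    MeasurableSet {ω | InWindow H ε w x₀ (T ω) m t u (τ ω)} := by
  have h : Measurable fun ω => incident H (central H ε w x₀ (T ω) t).x u := by
    simp only [incident_eq_edgeSum]
    exact (measurableRun_central hT t).edgeSum (g := fun _ => globalCoeff H u)
      (fun u => measurable_const) u
  exact (measurableSet_lt h (hτ.mul_const _)).inter
    (measurableSet_le (hτ.mul_const _) (h.add_const _))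

theorem measurable_windowSum (ha : ∀ u, Measurable fun ω => a ω u)
    (hT : ∀ v t, Measurable fun ω => T ω v t) {g : Ω → U → ℝ}
    (hg : ∀ u, Measurable fun ω => g ω u) (t : ℕ) (v : U) :
    Measurable fun ω => windowSum H ε w x₀ (a ω) (T ω) (g ω) t (fun u => T ω u t) v := by
  classical
  refine Finset.measurable_sum _ fun u _ =>
    ((hg u).mul ((measurableRun_simulate ha hT t).x v u)).mul ?_
  exact Measurable.ite (measurableSet_inWindow hT t u (hT u t)) measurable_const measurable_const

end Measurability

/-! ### Probability of the atypical events. -/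

section Events

open MeasureTheory ProbabilityTheory

variable {U : Type*} [Fintype U]

/-- Nonanticipation: the thresholds of iteration `t` are still fresh when the status at its start is
known. -/
theorem central_congr (H : SimpleGraph U) (ε : ℝ) (w : U → ℝ) (x₀ : U → U → ℝ)
    {T T' : U → ℕ → ℝ} {t : ℕ} (h : ∀ s < t, ∀ v, T v s = T' v s) :
    central H ε w x₀ T t = central H ε w x₀ T' t := by
  induction t with
  | zero => rfl
  | succ t ih =>
    simp only [central]
    rw [ih fun s hs => h s (by omega)]
    simp only [h t (by omega)]

theorem simulate_congr (H : SimpleGraph U) (ε : ℝ) (w : U → ℝ) (x₀ : U → U → ℝ) {m : ℕ}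
    (a : U → Fin m) {T T' : U → ℕ → ℝ} {t : ℕ} (h : ∀ s < t, ∀ v, T v s = T' v s) :
    simulate H ε w x₀ a T t = simulate H ε w x₀ a T' t := by
  induction t with
  | zero => rfl
  | succ t ih =>
    simp only [simulate]
    rw [ih fun s hs => h s (by omega)]
    simp only [h t (by omega)]

theorem windowSum_congr (H : SimpleGraph U) (ε : ℝ) (w : U → ℝ) (x₀ : U → U → ℝ) {m : ℕ}
    (a : U → Fin m) {T T' : U → ℕ → ℝ} {t : ℕ} (h : ∀ s < t, ∀ v, T v s = T' v s) (g : U → ℝ)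
    (τ : U → ℝ) (v : U) :
    windowSum H ε w x₀ a T g t τ v = windowSum H ε w x₀ a T' g t τ v := by
  unfold windowSum InWindow
  rw [central_congr H ε w x₀ h, simulate_congr H ε w x₀ a h]

/-- The uniform distribution on `[1 - 4ε, 1 - 2ε]`. -/
noncomputable abbrev thresholdLaw (ε : ℝ) : Measure ℝ :=
  ProbabilityTheory.cond volume (Set.Icc (1 - 4 * ε) (1 - 2 * ε))

theorem volume_Icc_threshold (ε : ℝ) :
    volume (Set.Icc (1 - 4 * ε) (1 - 2 * ε)) = ENNReal.ofReal (2 * ε) := by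
  rw [Real.volume_Icc]; ring_nf

theorem isProbabilityMeasure_thresholdLaw {ε : ℝ} (hε : 0 < ε) :
    IsProbabilityMeasure (thresholdLaw ε) := by
  refine cond_isProbabilityMeasure_of_finite ?_ ?_ <;> rw [volume_Icc_threshold]
  · simpa using hε
  · exact ENNReal.ofReal_ne_top

theorem thresholdLaw_window_le {ε : ℝ} (hε : 0 < ε) {y b w : ℝ} (hb : 0 ≤ b) (hw : 0 < w) :
    (thresholdLaw ε).real {τ | y < τ * w ∧ τ * w ≤ y + 2 * b * w} ≤ b / ε := by
  have hsub : {τ : ℝ | y < τ * w ∧ τ * w ≤ y + 2 * b * w} ⊆ Set.Icc (y / w) (y / w + 2 * b) := by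
    rintro τ ⟨h1, h2⟩
    constructor
    · rw [div_le_iff₀ hw]; exact h1.le
    · have : y / w + 2 * b = (y + 2 * b * w) / w := by field_simp
      rw [this, le_div_iff₀ hw]; exact h2
  have := isProbabilityMeasure_thresholdLaw hε
  refine ENNReal.toReal_le_of_le_ofReal (by positivity) ((measure_mono hsub).trans ?_)
  rw [cond_apply measurableSet_Icc, volume_Icc_threshold]
  calc _ ≤ (ENNReal.ofReal (2 * ε))⁻¹ * volume (Set.Icc (y / w) (y / w + 2 * b)) := by
        gcongr; exact Set.inter_subset_right
    _ = ENNReal.ofReal (b / ε) := by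
        rw [Real.volume_Icc, ← ENNReal.ofReal_inv_of_pos (by positivity),
          ← ENNReal.ofReal_mul (by positivity)]
        congr 1
        field_simp
        ring

/-- The law of the random choices of a phase on a graph with vertex type `U`. -/
noncomputable abbrev phaseLaw (U : Type*) [Fintype U] (ε : ℝ) (I m : ℕ) :
    Measure ((U → Fin I → ℝ) × (U → Fin m)) :=
  (Measure.pi fun _ => Measure.pi fun _ => thresholdLaw ε).prod
    (Measure.pi fun _ => uniformOn Set.univ)

theorem isProbabilityMeasure_machineLaw {m : ℕ} (hm : 0 < m) :
    IsProbabilityMeasure (uniformOn (Set.univ : Set (Fin m))) :=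
  have : Nonempty (Fin m) := ⟨⟨0, hm⟩⟩
  isProbabilityMeasure_uniformOn Set.finite_univ Set.univ_nonempty

theorem machineLaw_singleton {m : ℕ} (i : Fin m) :
    (uniformOn (Set.univ : Set (Fin m))).real {i} = 1 / m := by
  rw [measureReal_def, uniformOn_univ]
  simp

/-- Numerical hypotheses on a phase: `M` bounds the relative weight of a single edge after
rescaling, `R` the growth factor of the edge weights, and `Θ` is the parameter of the exponential
moments. -/
structure PhaseBounds (H : SimpleGraph U) (ε : ℝ) (w : U → ℝ) (x₀ : U → U → ℝ) (I m : ℕ)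
    (M R Θ : ℝ) : Prop where
  eps_pos : 0 < ε
  eps_lt : ε < 1 / 2
  machines_pos : 0 < m
  weight_pos : ∀ v, 0 < w v
  init_nonneg : ∀ u v, 0 ≤ x₀ u v
  init_sum : ∀ v, edgeSum (globalCoeff H v) x₀ v ≤ w v
  edge_le : ∀ t ≤ I, ∀ v u, m * (2 ^ t * x₀ v u) ≤ M * w v
  growth_le : ∀ t ≤ I, (2 : ℝ) ^ t ≤ R
  edge_nonneg : 0 ≤ M
  param_pos : 0 ≤ Θ
  param_le : Θ * M ≤ 1
  bias_le : bias m I ≤ ε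

namespace PhaseBounds

variable {H : SimpleGraph U} {ε : ℝ} {w : U → ℝ} {x₀ : U → U → ℝ} {I m : ℕ} {M R Θ : ℝ}

/-- Resampling column `t` leaves all windows and edge weights at time `t` fixed, so the window sum
is a weighted sum of independent indicators with mean at most `bias m t / ε * w v`; the event asks
for twice that. The assumption `g ≤ m` covers both kinds of coefficients. -/
theorem window_event_le (hB : PhaseBounds H ε w x₀ I m M R Θ) {t : ℕ} (ht : t < I) (v : U)
    {g : (U → Fin m) → U → ℝ} (hg : ∀ a u, 0 ≤ g a u) (hgm : ∀ a u, g a u ≤ m)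
    (hgmeas : ∀ u, Measurable fun a => g a u) :
    (phaseLaw U ε I m).real {ω |
      edgeSum (g ω.2) (simulate H ε w x₀ ω.2 (thresholds ω.1) t).x v ≤ w v ∧
      2 * (bias m t / ε) * w v < windowSum H ε w x₀ ω.2 (thresholds ω.1) (g ω.2) t
        (fun u => thresholds ω.1 u t) v} ≤
      Real.exp (-(Θ * bias m 0 / 4) + Θ ^ 2 * M * R) := by
  classical
  obtain ⟨hε, hε', hm, hw, hx₀, hsum, hedge, hgrow, hM, hΘ, hΘM, hb⟩ := hB
  have := isProbabilityMeasure_thresholdLaw hε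
  have := isProbabilityMeasure_machineLaw hm
  have hmeasT : ∀ (v : U) (t : ℕ), Measurable
      fun ω : (U → Fin I → ℝ) × (U → Fin m) => thresholds ω.1 v t :=
    measurable_thresholds fun v t => by fun_prop
  have hmeasA : ∀ u : U, Measurable fun ω : (U → Fin I → ℝ) × (U → Fin m) => ω.2 u :=
    fun u => by fun_prop
  have hmeasG : ∀ u : U, Measurable fun ω : (U → Fin I → ℝ) × (U → Fin m) => g ω.2 u :=
    fun u => (hgmeas u).comp measurable_snd
  have hE : MeasurableSet {ω : (U → Fin I → ℝ) × (U → Fin m) |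
      edgeSum (g ω.2) (simulate H ε w x₀ ω.2 (thresholds ω.1) t).x v ≤ w v ∧
      2 * (bias m t / ε) * w v < windowSum H ε w x₀ ω.2 (thresholds ω.1) (g ω.2) t
        (fun u => thresholds ω.1 u t) v} :=
    (measurableSet_le ((measurableRun_simulate hmeasA hmeasT t).edgeSum hmeasG v)
      measurable_const).inter
      (measurableSet_lt measurable_const (measurable_windowSum hmeasA hmeasT hmeasG t v))
  refine measureReal_le_of_resample (thresholdLaw ε) _ (⟨t, ht⟩ : Fin I) hE fun T a => ?_
  have hold : ∀ τ : U → ℝ, ∀ s < t, ∀ u,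
      thresholds (fun i => Function.update (T i) ⟨t, ht⟩ (τ i)) u s = thresholds T u s := by
    intro τ s hs u
    simp [thresholds, hs.trans ht, Function.update_of_ne, Fin.ext_iff, hs.ne]
  have hnew : ∀ τ : U → ℝ,
      (fun u => thresholds (fun i => Function.update (T i) ⟨t, ht⟩ (τ i)) u t) = τ := by
    intro τ
    funext u
    simp [thresholds, ht]
  simp only [Set.mem_ofPred_eq, hnew]
  simp only [windowSum_congr H ε w x₀ a (hold _), simulate_congr H ε w x₀ a (hold _)]
  -- This condition does not involve the resampled column, so if it fails the event is empty.
  by_cases hle : edgeSum (g a) (simulate H ε w x₀ a (thresholds T) t).x v ≤ w v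
  swap
  · simp only [hle, false_and, Set.ofPred_false, measureReal_empty]
    exact (Real.exp_pos _).le
  have hwv := hw v
  have hbt : 0 ≤ bias m t := bias_nonneg m t
  set c : U → ℝ := fun u => g a u * (simulate H ε w x₀ a (thresholds T) t).x v u with hc
  set J : U → Set ℝ := fun u => {τ | InWindow H ε w x₀ (thresholds T) m t u τ} with hJ
  have hs0 := simulate_x_nonneg H ε w x₀ a (thresholds T) hε' hx₀ t
  have hc0 : ∀ u, 0 ≤ c u := fun u => mul_nonneg (hg a u) (hs0 v u)
  have hcM : ∀ u, c u ≤ M * w v := fun u =>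
    (mul_le_mul (hgm a u) (simulate_x_le H ε w x₀ a (thresholds T) hε hε' hx₀ t v u) (hs0 v u)
      (by positivity)).trans (hedge t ht.le v u)
  have hJm : ∀ u, MeasurableSet (J u) := fun u =>
    measurableSet_inWindow (Ω := ℝ) (T := fun _ => thresholds T) (fun _ _ => measurable_const) t u
      measurable_id
  have hμ : ∑ u, c u * (thresholdLaw ε).real (J u) ≤ bias m t / ε * w v := by
    calc _ ≤ ∑ u, c u * (bias m t / ε) := Finset.sum_le_sum fun u _ =>
          mul_le_mul_of_nonneg_left (thresholdLaw_window_le hε hbt (hw u)) (hc0 u)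
      _ = bias m t / ε * edgeSum (g a) (simulate H ε w x₀ a (thresholds T) t).x v := by
          rw [← Finset.sum_mul, mul_comm]; rfl
      _ ≤ _ := mul_le_mul_of_nonneg_left hle (by positivity)
  have hch := measureReal_le_sum_indicator_le (thresholdLaw ε) (θ := Θ / w v) hJm hc0 hcM
    (by positivity) (by positivity) (by rw [div_mul_eq_mul_div, div_le_iff₀ hwv]; nlinarith) hμ
    (2 * (bias m t / ε) * w v)
  refine (measureReal_mono ?_).trans (hch.trans ?_)
  · rintro τ ⟨-, hτ⟩
    refine hτ.le.trans (le_of_eq ?_)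
    refine Finset.sum_congr rfl fun u _ => ?_
    simp only [hc, hJ, Set.indicator_apply, Set.mem_ofPred_eq]
  · rw [Real.exp_le_exp]
    have hR : 1 ≤ R := by simpa using hgrow 0 (Nat.zero_le _)
    have h1 : bias m t / ε ≤ 1 := by
      rw [div_le_one hε]; exact (bias_mono m ht.le).trans hb
    -- Wasteful, but it yields the same exponent as the sampling event, uniformly in `t`.
    have h2 : bias m 0 / 4 ≤ bias m t / ε := by
      have h3 := bias_mono m (Nat.zero_le t)
      have : bias m t / 4 ≤ bias m t / ε := div_le_div_of_nonneg_left hbt hε (by linarith)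
      linarith
    have e1 : Θ / w v * (2 * (bias m t / ε) * w v - bias m t / ε * w v) =
        Θ * (bias m t / ε) := by field_simp; ring
    have e2 : (Θ / w v) ^ 2 * (M * w v) * (bias m t / ε * w v) =
        Θ ^ 2 * M * (bias m t / ε) := by field_simp
    rw [e1, e2]
    have h4 := mul_le_mul_of_nonneg_left h2 hΘ
    have h5 := mul_le_mul_of_nonneg_left (h1.trans hR) (mul_nonneg (sq_nonneg Θ) hM)
    linarith

/-- For fixed thresholds the centralized weights are constants and only the partition is random. The
machine of `v` is random too, so both tails are bounded for every fixed machine; this costs the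
factor `2 * m`. -/
theorem sample_event_le (hB : PhaseBounds H ε w x₀ I m M R Θ) {t : ℕ} (ht : t ≤ I) (v : U) :
    (phaseLaw U ε I m).real {ω | bias m t / 4 * w v <
      |edgeSum (localCoeff H ω.2 v) (central H ε w x₀ (thresholds ω.1) t).x v -
        edgeSum (globalCoeff H v) (central H ε w x₀ (thresholds ω.1) t).x v|} ≤
      2 * m * Real.exp (-(Θ * bias m 0 / 4) + Θ ^ 2 * M * R) := by
  classical
  obtain ⟨hε, hε', hm, hw, hx₀, hsum, hedge, hgrow, hM, hΘ, hΘM, hb⟩ := hB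
  have := isProbabilityMeasure_thresholdLaw hε
  have := isProbabilityMeasure_machineLaw hm
  have hmeasT : ∀ (v : U) (t : ℕ), Measurable
      fun ω : (U → Fin I → ℝ) × (U → Fin m) => thresholds ω.1 v t :=
    measurable_thresholds fun v t => by fun_prop
  have hmeasA : ∀ u : U, Measurable fun ω : (U → Fin I → ℝ) × (U → Fin m) => ω.2 u :=
    fun u => by fun_prop
  have hrun := measurableRun_central (H := H) (ε := ε) (w := w) (x₀ := x₀) hmeasT t
  refine measureReal_prod_le_of_forall_left _ _ (measurableSet_lt measurable_const
    ((hrun.edgeSum (measurable_localCoeff H hmeasA v) v).sub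
      (hrun.edgeSum (g := fun _ => globalCoeff H v) (fun _ => measurable_const) v)).abs) fun T => ?_
  simp only [Set.mem_ofPred_eq]
  have hwv := hw v
  have hmR : (0 : ℝ) < m := Nat.cast_pos.2 hm
  set x := (central H ε w x₀ (thresholds T) t).x with hx
  have hx0 : ∀ u v, 0 ≤ x u v := central_x_nonneg H ε w x₀ (thresholds T) hε' hx₀ t
  have hxle : ∀ u v, x u v ≤ 2 ^ t * x₀ u v :=
    central_x_le H ε w x₀ (thresholds T) hε hε' hx₀ t
  set y := edgeSum (globalCoeff H v) x v with hy
  set c : U → ℝ := fun u => globalCoeff H v u * (m * x v u) with hc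
  have hc0 : ∀ u, 0 ≤ c u := fun u =>
    mul_nonneg (globalCoeff_nonneg H v u) (mul_nonneg hmR.le (hx0 v u))
  have hg1 : ∀ u, globalCoeff H v u ≤ 1 := fun u => by
    unfold globalCoeff; split_ifs <;> norm_num
  have hcM : ∀ u, c u ≤ M * w v := fun u => by
    have h1 := mul_le_of_le_one_left (mul_nonneg hmR.le (hx0 v u)) (hg1 u)
    exact h1.trans ((mul_le_mul_of_nonneg_left (hxle v u) hmR.le).trans (hedge t ht v u))
  have hyR : y ≤ R * w v := by
    calc y ≤ ∑ u, 2 ^ t * (globalCoeff H v u * x₀ v u) := Finset.sum_le_sum fun u _ => by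
          have := mul_le_mul_of_nonneg_left (hxle v u) (globalCoeff_nonneg H v u)
          linarith
      _ = 2 ^ t * edgeSum (globalCoeff H v) x₀ v := by rw [← Finset.mul_sum]; rfl
      _ ≤ 2 ^ t * w v := mul_le_mul_of_nonneg_left (hsum v) (by positivity)
      _ ≤ R * w v := mul_le_mul_of_nonneg_right (hgrow t ht) hwv.le
  have hmean : ∀ i : Fin m,
      ∑ u, c u * (uniformOn (Set.univ : Set (Fin m))).real {i} = y := fun i => by
    rw [hy, edgeSum]
    refine Finset.sum_congr rfl fun u _ => ?_
    rw [machineLaw_singleton, hc]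
    field_simp
  set l := bias m t / 4 * w v with hl
  set S : Fin m → (U → Fin m) → ℝ :=
    fun i a => ∑ u, c u * ({i} : Set (Fin m)).indicator (fun _ => (1 : ℝ)) (a u) with hS
  have hexp : -(Θ / w v * l) + (Θ / w v) ^ 2 * (M * w v) * y ≤
      -(Θ * bias m 0 / 4) + Θ ^ 2 * M * R := by
    have e1 : Θ / w v * l = Θ * (bias m t / 4) := by rw [hl]; field_simp
    have h1 : (Θ / w v) ^ 2 * (M * w v) * y ≤ (Θ / w v) ^ 2 * (M * w v) * (R * w v) :=
      mul_le_mul_of_nonneg_left hyR (by positivity)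
    have e2 : (Θ / w v) ^ 2 * (M * w v) * (R * w v) = Θ ^ 2 * M * R := by field_simp
    have h2 := mul_le_mul_of_nonneg_left (bias_mono m (Nat.zero_le t)) hΘ
    linarith
  have hΘ' : Θ / w v * (M * w v) ≤ 1 := by
    rw [div_mul_eq_mul_div, div_le_iff₀ hwv]; nlinarith
  have hup : ∀ i, (Measure.pi fun _ : U => uniformOn (Set.univ : Set (Fin m))).real
      {a | y + l ≤ S i a} ≤ Real.exp (-(Θ * bias m 0 / 4) + Θ ^ 2 * M * R) := fun i => by
    refine (measureReal_le_sum_indicator_le (uniformOn Set.univ) (fun _ => by measurability) hc0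
      hcM (by positivity) (θ := Θ / w v) (by positivity) hΘ' (hmean i).le (y + l)).trans ?_
    rw [Real.exp_le_exp, add_sub_cancel_left]
    exact hexp
  have hlow : ∀ i, (Measure.pi fun _ : U => uniformOn (Set.univ : Set (Fin m))).real
      {a | S i a ≤ y - l} ≤ Real.exp (-(Θ * bias m 0 / 4) + Θ ^ 2 * M * R) := fun i => by
    refine (measureReal_sum_indicator_le_le (uniformOn Set.univ) (fun _ => by measurability) hc0
      hcM (by positivity) (θ := Θ / w v) (by positivity) hΘ' (hmean i).le (y - l)).trans ?_
    rw [Real.exp_le_exp, hmean i, sub_sub_cancel]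
    exact hexp
  have hsub : {a : U → Fin m | l < |edgeSum (localCoeff H a v) x v - y|} ⊆
      ⋃ i, ({a | y + l ≤ S i a} ∪ {a | S i a ≤ y - l}) := by
    intro a ha
    have he : edgeSum (localCoeff H a v) x v = S (a v) a := by
      refine Finset.sum_congr rfl fun u _ => ?_
      by_cases h1 : H.Adj v u <;> by_cases h2 : a u = a v <;>
        simp [localCoeff, globalCoeff, hc, h1, h2]
    rw [Set.mem_ofPred_eq, he] at ha
    refine Set.mem_iUnion.2 ⟨a v, ?_⟩
    rcases lt_abs.1 ha with h | h
    · left; show y + l ≤ S (a v) a; linarith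
    · right; show S (a v) a ≤ y - l; linarith
  calc _ ≤ _ := measureReal_mono hsub
    _ ≤ ∑ i : Fin m, (Measure.pi fun _ : U => uniformOn (Set.univ : Set (Fin m))).real
        ({a | y + l ≤ S i a} ∪ {a | S i a ≤ y - l}) := measureReal_iUnion_fintype_le _
    _ ≤ ∑ _i : Fin m, 2 * Real.exp (-(Θ * bias m 0 / 4) + Θ ^ 2 * M * R) :=
        Finset.sum_le_sum fun i _ => (measureReal_union_le _ _).trans (by
          linarith [hup i, hlow i])
    _ = _ := by simp; ring

theorem ae_thresholds_mem (hε : 0 < ε) (hm : 0 < m) :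
    ∀ᵐ ω ∂phaseLaw U ε I m, ∀ t < I, ∀ v,
      thresholds ω.1 v t ∈ Set.Icc (1 - 4 * ε) (1 - 2 * ε) := by
  have := isProbabilityMeasure_thresholdLaw hε
  have := isProbabilityMeasure_machineLaw hm
  have h : ∀ (t : Fin I) (v : U), ∀ᵐ ω ∂phaseLaw U ε I m,
      ω.1 v t ∈ Set.Icc (1 - 4 * ε) (1 - 2 * ε) := by
    intro t v
    have h0 : ∀ᵐ τ ∂thresholdLaw ε, τ ∈ Set.Icc (1 - 4 * ε) (1 - 2 * ε) :=
      ae_cond_mem measurableSet_Icc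
    have h1 := (measurePreserving_eval (fun _ : Fin I => thresholdLaw ε)
      t).quasiMeasurePreserving.ae h0
    have h2 := (measurePreserving_eval (fun _ : U => Measure.pi fun _ : Fin I => thresholdLaw ε)
      v).quasiMeasurePreserving.ae h1
    exact Measure.quasiMeasurePreserving_fst.ae h2
  filter_upwards [ae_all_iff.2 fun t => ae_all_iff.2 (h t)] with ω hω t ht v
  simpa [thresholds, ht] using hω ⟨t, ht⟩ v

/-- Typical random choices are likely. -/
theorem measureReal_not_typical_le (hB : PhaseBounds H ε w x₀ I m M R Θ) :
    (phaseLaw U ε I m).real {ω | ¬ Typical H ε w x₀ ω.2 (thresholds ω.1) I} ≤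
      (I + 1) * Fintype.card U *
        ((2 * m + 2) * Real.exp (-(Θ * bias m 0 / 4) + Θ ^ 2 * M * R)) := by
  have := isProbabilityMeasure_thresholdLaw hB.eps_pos
  have := isProbabilityMeasure_machineLaw hB.machines_pos
  set q := Real.exp (-(Θ * bias m 0 / 4) + Θ ^ 2 * M * R) with hq
  have hq0 : 0 < q := Real.exp_pos _
  have hm1 : (1 : ℝ) ≤ m := Nat.one_le_cast.2 hB.machines_pos
  let A : ℕ → U → Set ((U → Fin I → ℝ) × (U → Fin m)) := fun t v => {ω | bias m t / 4 * w v <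
      |edgeSum (localCoeff H ω.2 v) (central H ε w x₀ (thresholds ω.1) t).x v -
        edgeSum (globalCoeff H v) (central H ε w x₀ (thresholds ω.1) t).x v|}
  -- The clause `t < I` empties the event at `t = I`, so one index range `t ≤ I` serves all events.
  let W : (U → (U → Fin m) → U → ℝ) → ℕ → U → Set ((U → Fin I → ℝ) × (U → Fin m)) :=
    fun g t v => {ω | t < I ∧
      edgeSum (g v ω.2) (simulate H ε w x₀ ω.2 (thresholds ω.1) t).x v ≤ w v ∧
      2 * (bias m t / ε) * w v < windowSum H ε w x₀ ω.2 (thresholds ω.1) (g v ω.2) t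
        (fun u => thresholds ω.1 u t) v}
  have hW : ∀ g : U → (U → Fin m) → U → ℝ, (∀ v a u, 0 ≤ g v a u) → (∀ v a u, g v a u ≤ m) →
      (∀ v u, Measurable fun a => g v a u) → ∀ t v, (phaseLaw U ε I m).real (W g t v) ≤ q := by
    intro g h0 h1 h2 t v
    by_cases ht : t < I
    · simpa only [W, ht, true_and] using hB.window_event_le ht v (h0 v) (h1 v) (h2 v)
    · simp only [W, ht, false_and, Set.ofPred_false, measureReal_empty]
      exact hq0.le
  let g₁ : U → (U → Fin m) → U → ℝ := fun v _ => globalCoeff H v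
  let g₂ : U → (U → Fin m) → U → ℝ := fun v a => localCoeff H a v
  have hW₁ := hW g₁ (fun v _ => globalCoeff_nonneg H v)
    (fun v _ u => by simp only [g₁, globalCoeff]; split_ifs <;> linarith)
    (fun v u => measurable_const)
  have hW₂ := hW g₂ (fun v a => localCoeff_nonneg H a v)
    (fun v a u => by simp only [g₂, localCoeff]; split_ifs <;> linarith)
    (fun v u => measurable_localCoeff H (fun u => measurable_pi_apply u) v u)
  -- The inclusion is only almost sure, because the thresholds lie in their interval almost surely.
  have hsub : {ω | ¬ Typical H ε w x₀ ω.2 (thresholds ω.1) I} ≤ᵐ[phaseLaw U ε I m]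
      ⋃ p ∈ Finset.range (I + 1) ×ˢ (Finset.univ : Finset U),
        (A p.1 p.2 ∪ (W g₁ p.1 p.2 ∪ W g₂ p.1 p.2)) := by
    filter_upwards [ae_thresholds_mem (U := U) (I := I) hB.eps_pos hB.machines_pos] with ω hω hnot
    by_contra hcon
    have hcon : ¬ ω ∈ ⋃ p ∈ Finset.range (I + 1) ×ˢ (Finset.univ : Finset U),
        (A p.1 p.2 ∪ (W g₁ p.1 p.2 ∪ W g₂ p.1 p.2)) := hcon
    simp only [Set.mem_iUnion, not_exists, Set.mem_union, not_or, Finset.mem_product,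
      Finset.mem_range, Finset.mem_univ, and_true, Prod.forall] at hcon
    refine hnot ⟨hω, fun t ht v => not_lt.1 (hcon t v (by omega)).1, fun t ht v h => ?_,
      fun t ht v h => ?_⟩
    · exact not_lt.1 fun h' => (hcon t v (by omega)).2.1 ⟨ht, h, h'⟩
    · exact not_lt.1 fun h' => (hcon t v (by omega)).2.2 ⟨ht, h, h'⟩
  calc _ ≤ (phaseLaw U ε I m).real (⋃ p ∈ Finset.range (I + 1) ×ˢ (Finset.univ : Finset U),
        (A p.1 p.2 ∪ (W g₁ p.1 p.2 ∪ W g₂ p.1 p.2))) :=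
        ENNReal.toReal_mono (measure_ne_top _ _) (measure_mono_ae hsub)
    _ ≤ ∑ p ∈ Finset.range (I + 1) ×ˢ (Finset.univ : Finset U), (phaseLaw U ε I m).real
        (A p.1 p.2 ∪ (W g₁ p.1 p.2 ∪ W g₂ p.1 p.2)) := measureReal_biUnion_finset_le _ _
    _ ≤ ∑ _p ∈ Finset.range (I + 1) ×ˢ (Finset.univ : Finset U), (2 * m + 2) * q := by
        refine Finset.sum_le_sum fun p hp => ?_
        have hp1 : p.1 ≤ I := by
          have := Finset.mem_range.1 (Finset.mem_product.1 hp).1; omega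
        have h1 := measureReal_union_le (μ := phaseLaw U ε I m) (A p.1 p.2)
          (W g₁ p.1 p.2 ∪ W g₂ p.1 p.2)
        have h2 := measureReal_union_le (μ := phaseLaw U ε I m) (W g₁ p.1 p.2) (W g₂ p.1 p.2)
        have h3 := hB.sample_event_le hp1 p.2
        have h4 := hW₁ p.1 p.2
        have h5 := hW₂ p.1 p.2
        have h6 : (phaseLaw U ε I m).real (A p.1 p.2) ≤ 2 * m * q := h3
        linarith
    _ = _ := by
        rw [Finset.sum_const, Finset.card_product, Finset.card_range, Finset.card_univ]
        simp only [nsmul_eq_mul]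
        push_cast
        ring

end PhaseBounds

end Events

/-! ### Reachable statuses and the numerical parameters of a phase. -/

section Phases

variable {V : Type*} [Fintype V] {G : SimpleGraph V} {w : V → ℝ} {ε : ℝ} {σ : State V}

theorem notMem_frozen_of_mem_high {v : V} (hv : v ∈ high G σ) : v ∉ σ.frozen := by
  classical
  exact (Finset.mem_filter.1 hv).2.1

theorem rpow_le_resDeg_of_mem_high {v : V} (hv : v ∈ high G σ) :
    avgDeg G σ ^ (0.95 : ℝ) ≤ (resDeg G σ v : ℝ) := by
  classical
  exact (Finset.mem_filter.1 hv).2.2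

theorem notMem_frozen_of_mem_inactive {v : V} (hv : v ∈ inactive G σ) : v ∉ σ.frozen := by
  classical
  exact (Finset.mem_filter.1 hv).2.1

theorem mem_high_or_mem_inactive {v : V} (hv : v ∉ σ.frozen) :
    v ∈ high G σ ∨ v ∈ inactive G σ := by
  classical
  simp only [high, inactive, Finset.mem_filter, Finset.mem_univ, true_and, hv, not_false_eq_true]
  exact le_or_gt _ _

theorem notMem_high_of_mem_inactive {v : V} (hv : v ∈ inactive G σ) : v ∉ high G σ := by
  classical
  exact fun h => absurd (Finset.mem_filter.1 hv).2.2 (not_lt.2 (rpow_le_resDeg_of_mem_high h))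

theorem initWeight_nonneg (h : ∀ v ∉ σ.frozen, 0 < resWeight G w σ v) (u v : high G σ) :
    0 ≤ initWeight G w σ u v :=
  le_min (div_nonneg (h u (notMem_frozen_of_mem_high u.2)).le (Nat.cast_nonneg _))
    (div_nonneg (h v (notMem_frozen_of_mem_high v.2)).le (Nat.cast_nonneg _))

/-- Only vertices of `V^high` get frozen. A surviving `v` in `V^high` failed the final test, so its
newly frozen edges weigh at most `y_{v,I}^{MPC} < w'(v)`; for an inactive `v` they weigh 0. -/
theorem resWeight_nextState_pos (hε' : ε < 1 / 2) {m : ℕ} (ω : Choices G σ m)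
    (h : ∀ v ∉ σ.frozen, 0 < resWeight G w σ v) :
    ∀ v ∉ (nextState G w ε σ ω).frozen, 0 < resWeight G w (nextState G w ε σ ω) v := by
  classical
  intro v hv
  have hvσ : v ∉ σ.frozen := fun h => hv (Finset.mem_union_left _ h)
  have hx0 : ∀ a b : high G σ, 0 ≤ (phaseMPC G w ε σ ω (numIter m)).x a b :=
    simulate_x_nonneg _ _ _ _ _ _ hε' (initWeight_nonneg h) _
  set f : V → ℝ := fun u => if hh : v ∈ high G σ ∧ u ∈ high G σ then
    (if G.Adj v u then (phaseMPC G w ε σ ω (numIter m)).x ⟨v, hh.1⟩ ⟨u, hh.2⟩ else 0) else 0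
    with hf
  have hf0 : ∀ u, 0 ≤ f u := fun u => by
    simp only [hf]; split_ifs <;> first | exact hx0 _ _ | exact le_rfl
  have hnew : ∀ u ∈ (nextState G w ε σ ω).frozen, u ∉ σ.frozen → u ∈ high G σ := by
    intro u hu huσ
    obtain ⟨u', -, rfl⟩ := Finset.mem_image.1 ((Finset.mem_union.1 hu).resolve_left huσ)
    exact u'.2
  have hpt : ∀ u, (if G.Adj v u ∧ (v ∈ (nextState G w ε σ ω).frozen ∨
      u ∈ (nextState G w ε σ ω).frozen) then (nextState G w ε σ ω).x v u else 0) ≤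
      (if G.Adj v u ∧ (v ∈ σ.frozen ∨ u ∈ σ.frozen) then σ.x v u else 0) + f u := by
    intro u
    by_cases hadj : G.Adj v u
    swap
    · simp [hadj, hf0]
    by_cases huσ : u ∈ σ.frozen
    · have hu : u ∈ (nextState G w ε σ ω).frozen := Finset.mem_union_left _ huσ
      have h1 : u ∉ high G σ := fun h => notMem_frozen_of_mem_high h huσ
      have h2 : u ∉ inactive G σ := fun h => notMem_frozen_of_mem_inactive h huσ
      have : (nextState G w ε σ ω).x v u = σ.x v u := by simp [nextState, h1, h2]
      rw [if_pos ⟨hadj, .inr hu⟩, if_pos ⟨hadj, .inr huσ⟩, this]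
      linarith [hf0 u]
    · rw [if_neg (c := G.Adj v u ∧ (v ∈ σ.frozen ∨ u ∈ σ.frozen)) (by tauto), zero_add]
      by_cases hu : u ∈ (nextState G w ε σ ω).frozen
      · rw [if_pos ⟨hadj, .inr hu⟩]
        have huh := hnew u hu huσ
        rcases mem_high_or_mem_inactive (G := G) hvσ with hvh | hvi
        · simp [nextState, hf, hvh, huh, hadj]
        · have hvh := notMem_high_of_mem_inactive hvi
          simp [nextState, hf, hvh, huh, hvi]
      · rw [if_neg (by tauto)]
        exact hf0 u
  have hfs : ∑ u, f u < resWeight G w σ v := by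
    by_cases hvh : v ∈ high G σ
    · have hlt : yMPC G w ε σ ω ⟨v, hvh⟩ (numIter m) < resWeight G w σ v := by
        by_contra hcon
        refine hv (Finset.mem_union_right _ (Finset.mem_image.2 ⟨⟨v, hvh⟩, ?_, rfl⟩))
        rw [Finset.mem_union, Finset.mem_filter]
        by_cases hfr : (⟨v, hvh⟩ : high G σ) ∈ (phaseMPC G w ε σ ω (numIter m)).frozen
        · exact .inl hfr
        · exact .inr ⟨Finset.mem_univ _, hfr, not_lt.1 hcon⟩
      refine lt_of_eq_of_lt ?_ hlt
      calc ∑ u, f u = ∑ u ∈ high G σ, f u :=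
            (Finset.sum_subset (Finset.subset_univ _) fun u _ hu => by simp [hf, hu]).symm
        _ = ∑ u : high G σ, f u := (Finset.sum_coe_sort _ _).symm
        _ = _ := by
            rw [yMPC, incident, Finset.sum_filter]
            refine Finset.sum_congr rfl fun u _ => ?_
            simp [hf, hvh, highGraph]
    · have : ∑ u, f u = 0 := Finset.sum_eq_zero fun u _ => by simp [hf, hvh]
      rw [this]
      exact h v hvσ
  have hsum := Finset.sum_le_sum fun u (_ : u ∈ Finset.univ) => hpt u
  rw [Finset.sum_add_distrib] at hsum
  simp only [resWeight, Finset.sum_filter] at hfs ⊢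
  linarith

theorem resWeight_pos_of_reachable (hε' : ε < 1 / 2) (hw : ∀ v, 0 < w v)
    (hσ : Reachable G w ε σ) : ∀ v ∉ σ.frozen, 0 < resWeight G w σ v := by
  induction hσ with
  | start => intro v _; simpa [resWeight] using hw v
  | phase σ m ω _ _ _ _ ih => exact resWeight_nextState_pos hε' ω ih

/-- There are at most `d(v)` edges at `v` in `G[V^high]`, each of weight at most `w'(v) / d(v)`. -/
theorem init_sum_le (h : ∀ v ∉ σ.frozen, 0 < resWeight G w σ v) (hd : 0 < avgDeg G σ)
    (v : high G σ) :
    edgeSum (globalCoeff (highGraph G σ) v) (initWeight G w σ) v ≤ highWeight G w σ v := by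
  classical
  have hdv : (0 : ℝ) < resDeg G σ v :=
    (Real.rpow_pos_of_pos hd _).trans_le (rpow_le_resDeg_of_mem_high v.2)
  have hwv := h v (notMem_frozen_of_mem_high v.2)
  have hcard : ∑ u, globalCoeff (highGraph G σ) v u ≤ (resDeg G σ v : ℝ) := by
    simp only [globalCoeff, Finset.sum_boole, resDeg, Nat.cast_le]
    refine Finset.card_le_card_of_injOn Subtype.val (fun u hu => ?_) Subtype.val_injective.injOn
    have hu := (Finset.mem_filter.1 hu).2
    exact Finset.mem_filter.2 ⟨Finset.mem_univ _, hu, notMem_frozen_of_mem_high u.2⟩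
  calc _ ≤ ∑ u, globalCoeff (highGraph G σ) v u * (resWeight G w σ v / resDeg G σ v) :=
        Finset.sum_le_sum fun u _ =>
          mul_le_mul_of_nonneg_left (min_le_left _ _) (globalCoeff_nonneg _ _ _)
    _ ≤ resDeg G σ v * (resWeight G w σ v / resDeg G σ v) := by
        rw [← Finset.sum_mul]
        exact mul_le_mul_of_nonneg_right hcard (by positivity)
    _ = _ := mul_div_cancel₀ _ hdv.ne'

theorem avgDeg_le_card (G : SimpleGraph V) (σ : State V) : avgDeg G σ ≤ Fintype.card V := by
  classical
  refine div_le_of_le_mul₀ (Nat.cast_nonneg _) (Nat.cast_nonneg _) ?_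
  calc _ ≤ ∑ _v : V, (Fintype.card V : ℝ) := by
        refine (Finset.sum_le_sum fun v _ => ?_).trans
          (Finset.sum_le_sum_of_subset_of_nonneg (Finset.subset_univ _)
            fun _ _ _ => Nat.cast_nonneg _)
        exact_mod_cast Finset.card_le_univ _
    _ = _ := by simp

theorem fifteen_pow_numIter_le {m : ℕ} (hm : 0 < m) :
    (15 : ℝ) ^ numIter m ≤ (m : ℝ) ^ (0.1 : ℝ) := by
  have hm' : (1 : ℝ) ≤ m := Nat.one_le_cast.2 hm
  have hl : 0 < Real.log 15 := Real.log_pos (by norm_num)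
  have h1 : (numIter m : ℝ) ≤ Real.log m / (10 * Real.log 15) :=
    Nat.floor_le (div_nonneg (Real.log_nonneg hm') (by positivity))
  rw [le_div_iff₀ (by positivity)] at h1
  rw [← Real.rpow_natCast, Real.rpow_def_of_pos (by norm_num), Real.rpow_def_of_pos (by linarith),
    Real.exp_le_exp]
  linarith

/-- The numerical hypotheses hold in every phase with sufficiently many machines; here
`z = m ^ 0.1`. -/
theorem phaseBounds_of_le (hε : 0 < ε) (hε' : ε < 1 / 2)
    (h : ∀ v ∉ σ.frozen, 0 < resWeight G w σ v) {m : ℕ} (hm : IsNumMachines G σ m)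
    {z : ℝ} (hz : z = (m : ℝ) ^ (0.1 : ℝ)) (hz4 : 4 ≤ z) (hzε : 2 / ε ≤ z) :
    ∃ M : ℝ, PhaseBounds (highGraph G σ) ε (highWeight G w σ) (initWeight G w σ) (numIter m) m
      M z (z ^ 3) ∧ z ^ 3 * bias m 0 / 4 = z / 2 ∧ (z ^ 3) ^ 2 * M * z ≤ 1 := by
  have hm0 : 0 < m := by
    rcases Nat.eq_zero_or_pos m with rfl | h0
    · rw [hz, Nat.cast_zero, Real.zero_rpow (by norm_num)] at hz4
      linarith
    · exact h0
  have hmR : (0 : ℝ) < m := Nat.cast_pos.2 hm0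
  have hz0 : 0 < z := by linarith
  have hz10 : z ^ 10 = m := by
    rw [hz, ← Real.rpow_natCast, ← Real.rpow_mul hmR.le]
    norm_num
  have hzinv : (m : ℝ) ^ (-(0.2 : ℝ)) = (z ^ 2)⁻¹ := by
    rw [hz, ← Real.rpow_natCast, ← Real.rpow_mul hmR.le, Real.rpow_neg hmR.le]
    norm_num
  have hm2 : (2 : ℝ) ≤ m := by
    rw [← hz10]
    calc (2 : ℝ) ≤ 4 ^ 10 := by norm_num
      _ ≤ z ^ 10 := by gcongr
  have hsq : (m : ℝ) / 2 ≤ √(avgDeg G σ) := by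
    have := (abs_lt.1 hm).2
    linarith
  have hd : (m : ℝ) ^ 2 / 4 ≤ avgDeg G σ := by
    have h1 := (Real.le_sqrt' (by positivity)).1 hsq
    linarith
  have hd0 : 0 < avgDeg G σ := lt_of_lt_of_le (by positivity) hd
  set D := avgDeg G σ ^ (0.95 : ℝ) with hD
  -- From `d ≥ m² / 4 = z^20 / 4`, raised to the power 0.95.
  have hDz : z ^ 19 / 4 ≤ D := by
    have e1 : ((m : ℝ) ^ 2) ^ (0.95 : ℝ) = z ^ 19 := by
      rw [← hz10, ← pow_mul, ← Real.rpow_natCast, ← Real.rpow_mul hz0.le, ← Real.rpow_natCast z 19]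
      norm_num
    have e2 : (4 : ℝ) ^ (0.95 : ℝ) ≤ 4 := by
      conv_rhs => rw [← Real.rpow_one 4]
      exact Real.rpow_le_rpow_of_exponent_le (by norm_num) (by norm_num)
    calc z ^ 19 / 4 ≤ z ^ 19 / 4 ^ (0.95 : ℝ) :=
          div_le_div_of_nonneg_left (by positivity) (by positivity) e2
      _ = ((m : ℝ) ^ 2 / 4) ^ (0.95 : ℝ) := by
          rw [Real.div_rpow (by positivity) (by norm_num), e1]
      _ ≤ D := Real.rpow_le_rpow (by positivity) hd (by norm_num)
  have hD0 : 0 < D := Real.rpow_pos_of_pos hd0 _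
  have hpow : ∀ t ≤ numIter m, (15 : ℝ) ^ t ≤ z := fun t ht =>
    (pow_le_pow_right₀ (by norm_num) ht).trans (hz ▸ fifteen_pow_numIter_le hm0)
  have hpow2 : ∀ t ≤ numIter m, (2 : ℝ) ^ t ≤ z := fun t ht =>
    (pow_le_pow_left₀ (by norm_num) (by norm_num) t).trans (hpow t ht)
  have h18 : z ^ 18 ≤ D := by
    calc z ^ 18 ≤ z ^ 18 * (z / 4) := le_mul_of_one_le_right (by positivity) (by linarith)
      _ = z ^ 19 / 4 := by ring
      _ ≤ D := hDz
  -- The factor `z^11` is `m = z^10` times the growth bound `2^t ≤ z`, and an initial edge weight is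
  -- at most `w' / D`. The quadratic Chernoff term is then `z^6 * (z^11 / D) * z = z^18 / D ≤ 1`.
  refine ⟨z ^ 11 / D, ⟨hε, hε', hm0, fun v => h v (notMem_frozen_of_mem_high v.2),
    initWeight_nonneg h, init_sum_le h hd0, ?_, hpow2, by positivity, by positivity, ?_, ?_⟩, ?_, ?_⟩
  · intro t ht v u
    have hwv : 0 < resWeight G w σ v := h v (notMem_frozen_of_mem_high v.2)
    have h1 : initWeight G w σ v u ≤ resWeight G w σ v / D :=
      (min_le_left _ _).trans
        (div_le_div_of_nonneg_left hwv.le hD0 (rpow_le_resDeg_of_mem_high v.2))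
    calc (m : ℝ) * (2 ^ t * initWeight G w σ v u) ≤ m * (z * (resWeight G w σ v / D)) := by
          refine mul_le_mul_of_nonneg_left ?_ hmR.le
          exact mul_le_mul (hpow2 t ht) h1 (initWeight_nonneg h v u) hz0.le
      _ = z ^ 11 / D * resWeight G w σ v := by rw [← hz10]; ring
  · rw [← mul_div_assoc, div_le_one hD0]
    calc z ^ 3 * z ^ 11 = z ^ 14 := by ring
      _ ≤ z ^ 18 := pow_le_pow_right₀ (by linarith) (by norm_num)
      _ ≤ D := h18
  · rw [bias, hzinv]
    have h2 := hpow _ le_rfl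
    calc 2 * (z ^ 2)⁻¹ * 15 ^ numIter m ≤ 2 * (z ^ 2)⁻¹ * z := by gcongr
      _ = 2 / z := by field_simp
      _ ≤ ε := by
          rw [div_le_iff₀ hz0]
          rw [div_le_iff₀ hε] at hzε
          linarith
  · rw [bias, hzinv, pow_zero]
    field_simp
    ring
  · rw [show (z ^ 3) ^ 2 * (z ^ 11 / D) * z = z ^ 18 / D by ring, div_le_one hD0]
    exact h18

/-- When `n` is large, every phase uses polylogarithmically many machines. -/
theorem mul_log_le_rpow {K : ℝ} (hK : 0 ≤ K) {L : ℝ} (hL : 1 ≤ L) (hLK : K ^ 10 + 1 ≤ L)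
    {d : ℝ} (hd : L ^ 30 < d) {m : ℕ} (hm : |(m : ℝ) - √d| < 1) :
    K * L ≤ (m : ℝ) ^ (0.1 : ℝ) := by
  have h1 : L ^ 15 ≤ √d := by
    rw [Real.le_sqrt' (by positivity)]
    linarith [show (L ^ 15) ^ 2 = L ^ 30 by ring]
  have h2 : (K * L) ^ 10 + 1 ≤ L ^ 15 := by
    have h3 : 1 ≤ L ^ 10 := one_le_pow₀ hL
    have h4 : L ≤ L ^ 5 := le_self_pow₀ hL (by norm_num)
    calc (K * L) ^ 10 + 1 ≤ K ^ 10 * L ^ 10 + L ^ 10 := by rw [mul_pow]; linarith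
      _ = (K ^ 10 + 1) * L ^ 10 := by ring
      _ ≤ L ^ 5 * L ^ 10 := by gcongr; linarith
      _ = L ^ 15 := by ring
  have h5 : (K * L) ^ 10 ≤ m := by
    have := (abs_lt.1 hm).1
    linarith
  calc K * L = ((K * L) ^ 10) ^ (0.1 : ℝ) := by
        rw [← Real.rpow_natCast, ← Real.rpow_mul (by positivity)]
        norm_num
    _ ≤ _ := Real.rpow_le_rpow (by positivity) h5 (by norm_num)

/-- The prefactor is at most `32 n³ ≤ exp(4 + 3L)`. With the 1 in the exponent of `q` this is at
most `exp(8L)`, which explains the 8 in `c + 8`. -/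
theorem union_bound_le {c L z k u m n : ℝ} (hn : 0 < n) (hL : L = Real.log n) (hL1 : 1 ≤ L)
    (hz : 2 * (c + 8) * L ≤ z) (hk : k + 1 ≤ 2 * m) (hu0 : 0 ≤ u) (hu : u ≤ n) (hm1 : 1 ≤ m)
    (hm : m ≤ 2 * n) {q : ℝ} (hq : q ≤ Real.exp (-(z / 2) + 1)) (hq0 : 0 ≤ q) :
    (k + 1) * u * ((2 * m + 2) * q) ≤ n ^ (-c) := by
  have hexp : (32 : ℝ) ≤ Real.exp 4 := by
    have h1 := Real.exp_one_gt_d9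
    calc (32 : ℝ) ≤ 2.7 ^ 4 := by norm_num
      _ ≤ (Real.exp 1) ^ 4 := by gcongr; linarith
      _ = Real.exp 4 := by rw [← Real.exp_nat_mul]; norm_num
  have hnL : n = Real.exp L := by rw [hL, Real.exp_log hn]
  calc (k + 1) * u * ((2 * m + 2) * q) ≤ (2 * m) * n * ((4 * m) * q) := by
        gcongr; linarith
    _ ≤ (2 * (2 * n)) * n * ((4 * (2 * n)) * Real.exp (-(z / 2) + 1)) := by gcongr
    _ = 32 * n ^ 3 * Real.exp (-(z / 2) + 1) := by ring
    _ ≤ Real.exp 4 * n ^ 3 * Real.exp (-(z / 2) + 1) := by gcongr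
    _ = Real.exp (4 + 3 * L + (-(z / 2) + 1)) := by
        rw [hnL, ← Real.exp_nat_mul, ← Real.exp_add, ← Real.exp_add]; norm_num
    _ ≤ Real.exp (L * -c) := by rw [Real.exp_le_exp]; linarith
    _ = n ^ (-c) := by rw [Real.rpow_def_of_pos hn, ← hL]

end Phases

end MWVC

theorem mainTheorem3 (ε : ℝ) (hε : 0 < ε) (hε' : ε < 1 / 2) (c : ℝ) (hc : 0 < c) :
    ∃ N : ℕ, ∀ (V : Type*) [Fintype V] (G : SimpleGraph V) (w : V → ℝ),
      N ≤ Fintype.card V → (∀ v, 0 < w v) →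
      ∀ σ : MWVC.State V, MWVC.Reachable G w ε σ → MWVC.PhaseRuns G σ →
      ∀ m : ℕ, MWVC.IsNumMachines G σ m →
        1 - (Fintype.card V : ℝ) ^ (-c) ≤
          (MWVC.choiceLaw G ε σ m).real
            {ω | ∀ t ≤ MWVC.numIter m, ∀ v : MWVC.high G σ,
              |MWVC.yCentral G w ε σ ω v t - MWVC.yTildeMPC G w ε σ ω v t|
                  ≤ 6 * ε * MWVC.highWeight G w σ v ∧
              |MWVC.yCentral G w ε σ ω v t - MWVC.yMPC G w ε σ ω v t|
                  ≤ 6 * ε * MWVC.highWeight G w σ v} := by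
  -- The first summand pays for the union bound; the second makes the final bias, at most `2 / z`,
  -- no larger than ε.
  set K : ℝ := 2 * (c + 8) + 2 / ε with hK
  have h2ε : 0 < 2 / ε := by positivity
  have hK0 : 0 ≤ K := by positivity
  refine ⟨⌈Real.exp (K ^ 10 + 1)⌉₊, fun V _ G w hN hw σ hσ hrun m hm => ?_⟩
  set n : ℝ := (Fintype.card V : ℝ) with hn
  set L := Real.log n with hL
  have hN' : Real.exp (K ^ 10 + 1) ≤ n := (Nat.le_ceil _).trans (Nat.cast_le.2 hN)
  have hn0 : 0 < n := (Real.exp_pos _).trans_le hN'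
  have hLK : K ^ 10 + 1 ≤ L := (Real.le_log_iff_exp_le hn0).2 hN'
  have hL1 : 1 ≤ L := le_trans (by linarith [pow_nonneg hK0 10]) hLK
  have hn1 : 1 ≤ n := by
    have := Real.add_one_le_exp (K ^ 10 + 1)
    linarith [pow_nonneg hK0 10]
  set z := (m : ℝ) ^ (0.1 : ℝ) with hz
  have hzKL : K * L ≤ z := MWVC.mul_log_le_rpow hK0 hL1 hLK hrun hm
  have hzK : K ≤ z := (le_mul_of_one_le_right hK0 hL1).trans hzKL
  have hres := MWVC.resWeight_pos_of_reachable hε' hw hσ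
  obtain ⟨M, hB, hΘ, hM⟩ := MWVC.phaseBounds_of_le hε hε' hres hm hz (by linarith) (by linarith)
  have hm1 : (1 : ℝ) ≤ m := Nat.one_le_cast.2 hB.machines_pos
  have hprob := hB.measureReal_not_typical_le
  have hI : (MWVC.numIter m : ℝ) + 1 ≤ 2 * m := by
    have h1 : ((MWVC.numIter m : ℕ) : ℝ) ≤ 15 ^ MWVC.numIter m := by
      exact_mod_cast (Nat.lt_pow_self (by norm_num)).le
    have h2 := MWVC.fifteen_pow_numIter_le hB.machines_pos
    have h3 : (m : ℝ) ^ (0.1 : ℝ) ≤ m := by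
      conv_rhs => rw [← Real.rpow_one (m : ℝ)]
      exact Real.rpow_le_rpow_of_exponent_le hm1 (by norm_num)
    linarith
  have hmn : (m : ℝ) ≤ 2 * n := by
    have h1 : √(MWVC.avgDeg G σ) ≤ n := by
      rw [Real.sqrt_le_left hn0.le]
      have := MWVC.avgDeg_le_card G σ
      nlinarith
    have := (abs_lt.1 hm).2
    linarith
  have hcard : (Fintype.card (MWVC.high G σ) : ℝ) ≤ n := by
    rw [Fintype.card_coe]
    exact Nat.cast_le.2 (Finset.card_le_univ _)
  have hbound := hprob.trans (MWVC.union_bound_le (c := c) hn0 hL hL1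
    (le_trans (by nlinarith) hzKL) hI (Nat.cast_nonneg _) hcard hm1 hmn
    (Real.exp_le_exp.2 (by rw [hΘ]; linarith)) (Real.exp_pos _).le)
  have := MWVC.isProbabilityMeasure_thresholdLaw hε
  have := MWVC.isProbabilityMeasure_machineLaw hB.machines_pos
  -- The law of the phase is definitionally `phaseLaw` on the vertex type `high G σ`.
  change _ ≤ (MWVC.phaseLaw (MWVC.high G σ) ε (MWVC.numIter m) m).real _
  set P := MWVC.phaseLaw (MWVC.high G σ) ε (MWVC.numIter m) m with hP
  set S : Set ((MWVC.high G σ → Fin (MWVC.numIter m) → ℝ) × (MWVC.high G σ → Fin m)) :=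
    {ω | MWVC.Typical (MWVC.highGraph G σ) ε (MWVC.highWeight G w σ) (MWVC.initWeight G w σ)
      ω.2 (MWVC.thresholds ω.1) (MWVC.numIter m)} with hS
  have hSprob : 1 ≤ P.real S + P.real Sᶜ := by
    have h1 : P.real (S ∪ Sᶜ) = 1 := by
      rw [Set.union_compl_self]
      exact MeasureTheory.probReal_univ
    exact h1.symm.trans_le (MeasureTheory.measureReal_union_le _ _)
  have hSc : P.real Sᶜ ≤ n ^ (-c) := hbound
  refine le_trans (by linarith) (MeasureTheory.measureReal_mono (s₁ := S) fun ω hω t ht v => ?_)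
  exact MWVC.abs_sub_le_of_typical hε hε' hB.init_nonneg hB.weight_pos hω hB.bias_le ht v
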